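/- Let $G$ be a countably infinite discrete amenable group acting by measure-preserving transformations on a Lebesgue space $(X,\mathcal B,\mu)$ (a complete probability space isomorphic mod $0$ to the completion of a Borel probability measure on $\mathbb R$). Let $\mathcal A\subseteq\mathcal B$ be a sub-$\sigma$-algebra such that $gA\in\mathcal A$ for all $g\in G$, $A\in\mathcal A$, and let $\mathcal C$ be the (unique mod $0$) measurable partition such that the classes mod $0$ of the measurable unions of elements of $\mathcal C$ are exactly the classes mod $0$ of the sets of $\mathcal A$. For measurable partitions $\alpha,\beta$ put $H_\mu(\alpha\mid\beta)=\int_{X/\beta}H_{\mu_B}(\alpha|_B)\,d\mu_\beta(B)\in[0,\infty]$, where $\{\mu_B\}_{B\in\beta}$ is the canonical system of conditional measures of $\mu$ associated with $\beta$, $\mu_\beta$ is the measure of the factor space $X/\beta$, and $H_\nu(\xi)=-\sum_l\nu(A_l)\log\nu(A_l)$ if the elements $A_1,A_2,\dots$ of $\xi$ of positive $\nu$-measure cover almost all of the space, $H_\nu(\xi)=\infty$ otherwise. Let $\mathcal Z(\mathcal C)$ be the set of measurable partitions $\alpha$ with $H_\mu(\alpha\mid\mathcal C)<\infty$. For $\alpha\in\mathcal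 Z(\mathcal C)$ let $$h^{\mathcal A}_\mu(T,\alpha)=\lim_F\frac1{|F|}H_\mu(\alpha^F\mid\mathcal C),\qquad \alpha^F=\bigvee_{g\in F}g^{-1}\alpha,$$ where the limit is taken as the nonempty finite set $F\subseteq G$ becomes more and more invariant: the quantity tends to $L$ if for every neighbourhood $U$ of $L$ there are a finite $K\subseteq G$ and $\delta>0$ such that the quantity lies in $U$ for every nonempty finite $F\subseteq G$ with $|gF\,\triangle\,F|\le\delta|F|$ for all $g\in K$. Write $\alpha\le\beta$ if there is a null set off which every element of $\beta$ is contained in an element of $\alpha$. Then the limit $h^{\mathcal A}_\mu(T,\alpha)$ exists for every $\alpha\in\mathcal Z(\mathcal C)$, and for all $\alpha,\beta\in\mathcal Z(\mathcal C)$: 1. $h^{\mathcal A}_\mu(T,\alpha)\le H_\mu(\alpha\mid\mathcal C)$; 2. $\alpha\vee\beta\in\mathcal Z(\mathcal C)$ and $h^{\mathcal A}_\mu(T,\alpha\vee\beta)\le h^{\mathcal A}_\mu(T,\alpha)+h^{\mathcal A}_\mu(T,\beta)$; 3. if $\alpha\le\beta$, then $h^{\mathcal A}_\mu(T,\alpha)\le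 h^{\mathcal A}_\mu(T,\beta)$; 4. $h^{\mathcal A}_\mu(T,\alpha)\le h^{\mathcal A}_\mu(T,\beta)+H_\mu(\alpha\mid\beta\vee\mathcal C)$. -/

import Mathlib

open MeasureTheory Filter Topology
open scoped ENNReal

noncomputable section

/-- A Lebesgue space: a complete probability space that is isomorphic mod 0 to the completion of
a Borel probability measure `ν` on the real line. The isomorphism `f` is a bijection between sets
`X₀`, `Y₀` of full measure; it respects measurability in both directions (measurability for the
completion of `ν` is null-measurability) and it respects the measures. -/
structure IsLebesgueSpace {X : Type*} [MeasurableSpace X] (μ : Measure X) : Prop where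
  isProbabilityMeasure : IsProbabilityMeasure μ
  isComplete : μ.IsComplete
  exists_iso : ∃ (ν : Measure ℝ) (X₀ : Set X) (Y₀ : Set ℝ) (f : X → ℝ),
    IsProbabilityMeasure ν ∧ μ X₀ᶜ = 0 ∧ ν Y₀ᶜ = 0 ∧ Set.BijOn f X₀ Y₀ ∧
    (∀ S ⊆ X₀, MeasurableSet S ↔ NullMeasurableSet (f '' S) ν) ∧
    (∀ S ⊆ X₀, MeasurableSet S → ν (f '' S) = μ S)

section Partitions

/-! A partition of `X` is encoded by its equivalence relation `α : Setoid X`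
(`α x y` means that `x` and `y` lie in the same element of the partition). The factor space `X/α`
is `Quotient α`, with the quotient σ-algebra. -/

variable {X : Type*}

/-- `S` is an `α`-set: a union of elements of the partition `α`. -/
def IsPartitionSet (α : Setoid X) (S : Set X) : Prop :=
  ∀ x y, α x y → x ∈ S → y ∈ S

/-- A measurable partition: there are countably many measurable `α`-sets which separate the
elements of `α`. -/
def IsMeasurablePartition [MeasurableSpace X] (α : Setoid X) : Prop :=
  ∃ S : ℕ → Set X, (∀ n, MeasurableSet (S n)) ∧ (∀ n, IsPartitionSet α (S n)) ∧
    ∀ x y, ¬ α x y → ∃ n, ¬ (x ∈ S n ↔ y ∈ S n)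

/-- The join `α ∨ β`: its elements are the nonempty intersections of elements of `α` and `β`.
(The order of `Setoid X` is the inclusion of relations, so the join of partitions is its `⊓`.) -/
def partitionJoin (α β : Setoid X) : Setoid X := α ⊓ β

/-- `α ≤ β` mod 0: off a null set, every element of `β` is contained in an element of `α`. -/
def PartitionLE [MeasurableSpace X] (μ : Measure X) (α β : Setoid X) : Prop :=
  ∃ N : Set X, μ N = 0 ∧ ∀ x ∉ N, ∀ y ∉ N, β x y → α x y

/-- `α^F = ⋁_{g ∈ F} g⁻¹ α`: two points lie in the same element iff their images under every
`g ∈ F` lie in the same element of `α`. -/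
def partitionOrbit {G : Type*} [Group G] [MulAction G X] (α : Setoid X) (F : Finset G) :
    Setoid X :=
  ⨅ g ∈ F, Setoid.comap (fun x : X => g • x) α

/-- The measure `μ_β` of the factor space `X/β`. -/
def factorMeasure [MeasurableSpace X] (μ : Measure X) (β : Setoid X) : Measure (Quotient β) :=
  μ.map (Quotient.mk β)

/-- The element of the partition `β` which corresponds to the point `b` of `X/β`. -/
abbrev PartitionFiber (β : Setoid X) (b : Quotient β) : Type _ :=
  {x : X // Quotient.mk β x = b}

/-- A canonical system of conditional measures of `μ` associated with `β`. Each element of `β`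
has its own σ-algebra, and the trace on almost every element of a measurable subset of `X` is
measurable there. -/
structure CanonicalSystem [MeasurableSpace X] (μ : Measure X) (β : Setoid X) where
  /-- the σ-algebra of an element -/
  sigma : ∀ b : Quotient β, MeasurableSpace (PartitionFiber β b)
  /-- the conditional measure on an element -/
  meas : ∀ b : Quotient β, @Measure (PartitionFiber β b) (sigma b)
  isLebesgueSpace : ∀ᵐ b ∂(factorMeasure μ β),
    @IsLebesgueSpace (PartitionFiber β b) (sigma b) (meas b)
  measurableSet_trace : ∀ S : Set X, MeasurableSet S → ∀ᵐ b ∂(factorMeasure μ β),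
    MeasurableSet[sigma b] ((Subtype.val : PartitionFiber β b → X) ⁻¹' S)
  measurable_meas : ∀ S : Set X, MeasurableSet S →
    Measurable (fun b => meas b ((Subtype.val : PartitionFiber β b → X) ⁻¹' S))
  lintegral_meas : ∀ S : Set X, MeasurableSet S →
    μ S = ∫⁻ b, meas b ((Subtype.val : PartitionFiber β b → X) ⁻¹' S) ∂(factorMeasure μ β)

open Classical in
/-- The entropy `H_ν(α) ∈ [0, ∞]`: the sum of `-ν(A) log ν(A)` over the elements `A` of `α` if
the elements of positive measure cover almost everything, and `∞` otherwise. (Elements of measure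
zero contribute `0` to the sum.) -/
def partitionEntropy {Y : Type*} [MeasurableSpace Y] (ν : Measure Y) (α : Setoid Y) : ℝ≥0∞ :=
  if ν {y | ν {z | α y z} = 0} = 0 then
    ∑' q : Quotient α, ENNReal.ofReal (Real.negMulLog (ν {z | Quotient.mk α z = q}).toReal)
  else ⊤

open Classical in
/-- The mean conditional entropy `H_μ(α | β) = ∫_{X/β} H_{μ_B}(α_B) dμ_β ∈ [0, ∞]`, where `(μ_B)`
is a canonical system of conditional measures associated with `β` and `α_B` is the restriction of
`α` to `B`. Such a system exists, and is essentially unique, when `β` is a measurable partition of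
a Lebesgue space. -/
def condEntropy [MeasurableSpace X] (μ : Measure X) (α β : Setoid X) : ℝ≥0∞ :=
  if h : Nonempty (CanonicalSystem μ β) then
    ∫⁻ b, @partitionEntropy (PartitionFiber β b) (h.some.sigma b) (h.some.meas b)
      (Setoid.comap Subtype.val α) ∂(factorMeasure μ β)
  else ⊤

/-- The measurable partition `C` corresponds to the sub-σ-algebra `A`: the classes mod 0 of the
measurable `C`-sets are exactly the classes mod 0 of the sets in `A`. -/
def IsPartitionOfSigmaAlgebra (A : MeasurableSpace X) [B : MeasurableSpace X] (μ : Measure X)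
    (C : Setoid X) : Prop :=
  @IsMeasurablePartition X B C ∧ ∀ S : Set X, MeasurableSet[B] S →
    ((∃ S', MeasurableSet[B] S' ∧ IsPartitionSet C S' ∧ S =ᵐ[μ] S') ↔
      ∃ S', MeasurableSet[A] S' ∧ S =ᵐ[μ] S')

/-- `Z(C)`: the measurable partitions `α` with `H_μ(α | C) < ∞`. -/
def finiteCondEntropyPartitions [MeasurableSpace X] (μ : Measure X) (C : Setoid X) :
    Set (Setoid X) :=
  {α | IsMeasurablePartition α ∧ condEntropy μ α C < ⊤}

end Partitions

section Amenable

/-- The invariance defect `|gF ∆ F| / |F|`. -/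
def invarianceDefect {G : Type*} [Group G] (g : G) (F : Finset G) : ℝ :=
  ((symmDiff ((fun x => g * x) '' (F : Set G)) (F : Set G)).ncard : ℝ) / (F.card : ℝ)

/-- Amenability of a countable discrete group: there is a Følner sequence of nonempty finite
subsets. -/
def IsAmenableGroup (G : Type*) [Group G] : Prop :=
  ∃ F : ℕ → Finset G, (∀ n, (F n).Nonempty) ∧
    ∀ g : G, Tendsto (fun n => invarianceDefect g (F n)) atTop (𝓝 0)

/-- The filter "`F` becomes more and more invariant" on the finite subsets of `G`. It is generated
by the sets of all nonempty finite `F` with `|gF ∆ F| ≤ δ |F|` for all `g ∈ K`, where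
`K ⊆ G` is finite and `δ > 0`. -/
def moreAndMoreInvariant (G : Type*) [Group G] : Filter (Finset G) :=
  ⨅ (K : Finset G) (δ : ℝ) (_ : 0 < δ),
    𝓟 {F : Finset G | F.Nonempty ∧ ∀ g ∈ K, invarianceDefect g F ≤ δ}

end Amenable

section Dynamics

variable {X : Type*} [MeasurableSpace X]

/-- The average `H_μ(α^F | C) / |F|`. -/
def meanOrbitEntropy {G : Type*} [Group G] [MulAction G X] (μ : Measure X) (C α : Setoid X)
    (F : Finset G) : ℝ≥0∞ :=
  condEntropy μ (partitionOrbit α F) C / (F.card : ℝ≥0∞)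

/-- `h^A_μ(T, α)`, where `C` is the measurable partition that corresponds to `A`: the limit of
`H_μ(α^F | C) / |F|` as `F` becomes more and more invariant. -/
def condEntropyOfAction (G : Type*) [Group G] [MulAction G X] (μ : Measure X) (C α : Setoid X) :
    ℝ≥0∞ :=
  limUnder (moreAndMoreInvariant G) (meanOrbitEntropy (G := G) μ C α)

end Dynamics

end

/-!
# Entropy of an amenable group action relative to an invariant σ-algebra

**Reduction to finite partitions.** A measurable partition `α` is the increasing join of finite
partitions, the level sets of maps `ξ n` with values in finite types (`Exhausts`,
`exhausts_firstCode`). On one fibre the entropy of a partition is the integral of its information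
function `-log ν([y])`, even if the partition is not countable mod 0, and for `ξ n` this function
increases to the one of `α` (`partitionEntropy_eq_iSup`). The measures of a canonical system of `β`
are versions of the conditional probabilities given the σ-algebra `partitionSigma β` of measurable
`β`-sets. So whenever a canonical system exists, `H(α | β)` is the supremum of the ordinary
conditional entropies `H(ξ n | partitionSigma β)` (`condEntropy_eq_iSup`), whichever system was
chosen. In particular `C` may be replaced by the invariant σ-algebra `A`.

**Finite calculus.** For finite partitions the proof uses monotonicity, the chain rule
(`finiteCondEntropy_prod`), monotonicity in the σ-algebra modulo null sets
(`finiteCondEntropy_anti`, by Jensen's inequality), Lévy's upward theorem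
(`tendsto_finiteCondEntropy`) and invariance under measure-preserving maps.

**Existence of the limit.** The chain rule makes `F ↦ H(ξ^F | A)` submodular, and it is invariant
under right translations because `A` is invariant. By Shearer's inequality for the cover of `F` by
the translates `K c`, `c ∈ K⁻¹ F`, one gets `|K| H(α^F | A) ≤ |K⁻¹ F| H(α^K | A)`; as `F` becomes
more and more invariant, `|K⁻¹ F| / |F|` tends to `1`, so the averages converge to their infimum
(`tendsto_div_card_moreAndMoreInvariant`).

**The inequalities.** The first two follow from the infimum and from subadditivity. For the other
two, `H(ξ^F | A) ≤ H(η^F | A) + |F| H(ξ | A ⊔ σ(η))` for finite partitions, and `η` is let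
increase to `β` (`orbitEntropy_le_add`). What remains is to identify the σ-algebra generated by `A`
and `β` with the one of the measurable `β ∨ C`-sets, mod 0. This is where the Lebesgue space enters:
a measurable set that a countable family separates from its complement belongs, modulo null sets, to
the σ-algebra generated by the family, because disjoint analytic sets are separated by Borel sets
(`IsLebesgueSpace.exists_ae_eq_of_separating`).
-/

noncomputable section

/-! ### Conditional entropy of finite partitions -/

section FiniteEntropy

variable {Ω : Type*} {m m' mΩ : MeasurableSpace Ω} {μ : Measure Ω}

/-- The conditional probability `μ(S | m)`, a version of the conditional expectation of `1_S`. -/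
abbrev condProb {mΩ : MeasurableSpace Ω} (μ : Measure Ω) (m : MeasurableSpace Ω) (S : Set Ω) :
    Ω → ℝ :=
  μ[S.indicator (fun _ => (1 : ℝ)) | m]

lemma integrable_indicator_one [IsFiniteMeasure μ] {S : Set Ω} (hS : MeasurableSet S) :
    Integrable (S.indicator (fun _ => (1 : ℝ))) μ :=
  (integrable_const _).indicator hS

lemma condProb_nonneg (S : Set Ω) : ∀ᵐ x ∂μ, 0 ≤ condProb μ m S x :=
  condExp_nonneg (ae_of_all _ fun x => Set.indicator_nonneg (fun _ _ => zero_le_one) x)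

lemma condProb_le_one [IsProbabilityMeasure μ] (hm : m ≤ mΩ) {S : Set Ω}
    (hS : MeasurableSet S) : ∀ᵐ x ∂μ, condProb μ m S x ≤ 1 := by
  have h := condExp_mono (m := m) (integrable_indicator_one (μ := μ) hS)
    (integrable_const (1 : ℝ))
    (ae_of_all _ fun x => Set.indicator_le_self' (fun _ _ => zero_le_one) x)
  rw [condExp_const hm] at h
  exact h

lemma condProb_empty : condProb μ m (∅ : Set Ω) = 0 := by
  unfold condProb
  rw [Set.indicator_empty]
  exact condExp_zero

lemma condProb_mono [IsFiniteMeasure μ] {S T : Set Ω} (hS : MeasurableSet S)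
    (hT : MeasurableSet T) (h : S ⊆ T) : ∀ᵐ x ∂μ, condProb μ m S x ≤ condProb μ m T x :=
  condExp_mono (integrable_indicator_one hS) (integrable_indicator_one hT)
    (ae_of_all _ fun x => Set.indicator_le_indicator_of_subset h (fun _ => zero_le_one) x)

lemma negMulLog_le_one {x : ℝ} (h0 : 0 ≤ x) : Real.negMulLog x ≤ 1 := by
  have h := Real.self_sub_one_le_mul_log h0
  rw [Real.negMulLog]
  linarith

lemma negMulLog_add_le {x y : ℝ} (hx : 0 ≤ x) (hy : 0 ≤ y) :
    Real.negMulLog (x + y) ≤ Real.negMulLog x + Real.negMulLog y := by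
  rcases hx.eq_or_lt with rfl | hx
  · simp
  rcases hy.eq_or_lt with rfl | hy
  · simp
  have h1 := Real.log_le_log hx (by linarith : x ≤ x + y)
  have h2 := Real.log_le_log hy (by linarith : y ≤ x + y)
  simp only [Real.negMulLog]
  nlinarith

lemma negMulLog_sum_le {ι : Type*} (s : Finset ι) (p : ι → ℝ) (hp : ∀ i ∈ s, 0 ≤ p i) :
    Real.negMulLog (∑ i ∈ s, p i) ≤ ∑ i ∈ s, Real.negMulLog (p i) := by
  classical
  induction s using Finset.induction_on with
  | empty => simp
  | insert a s ha ih =>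
    rw [Finset.sum_insert ha, Finset.sum_insert ha]
    have h0 : 0 ≤ ∑ i ∈ s, p i :=
      Finset.sum_nonneg fun i hi => hp i (Finset.mem_insert_of_mem hi)
    have := negMulLog_add_le (hp a (Finset.mem_insert_self a s)) h0
    have := ih fun i hi => hp i (Finset.mem_insert_of_mem hi)
    linarith

lemma integrable_negMulLog_comp [IsFiniteMeasure μ] {f : Ω → ℝ} (hf : AEStronglyMeasurable f μ)
    (h0 : ∀ᵐ x ∂μ, 0 ≤ f x) (h1 : ∀ᵐ x ∂μ, f x ≤ 1) :
    Integrable (fun x => Real.negMulLog (f x)) μ := by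
  refine Integrable.of_bound (Real.continuous_negMulLog.comp_aestronglyMeasurable hf) 1 ?_
  filter_upwards [h0, h1] with x hx0 hx1
  rw [Real.norm_of_nonneg (Real.negMulLog_nonneg hx0 hx1)]
  exact negMulLog_le_one hx0

lemma integrable_negMulLog_condProb [IsProbabilityMeasure μ] (hm : m ≤ mΩ) {S : Set Ω}
    (hS : MeasurableSet S) : Integrable (fun x => Real.negMulLog (condProb μ m S x)) μ :=
  integrable_negMulLog_comp integrable_condExp.aestronglyMeasurable (condProb_nonneg S)
    (condProb_le_one hm hS)

/-- The conditional entropy `H(ξ | m)` of a finite-valued function `ξ` given a σ-algebra `m`,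
equivalently of the finite partition into the level sets of `ξ`. -/
def finiteCondEntropy {ι : Type*} [Fintype ι] {mΩ : MeasurableSpace Ω} (μ : Measure Ω)
    (m : MeasurableSpace Ω) (ξ : Ω → ι) : ℝ :=
  ∑ i, ∫ x, Real.negMulLog (condProb μ m (ξ ⁻¹' {i}) x) ∂μ

variable {ι κ : Type*} [Fintype ι] [Fintype κ] [MeasurableSpace ι] [MeasurableSpace κ]
  [MeasurableSingletonClass ι] [MeasurableSingletonClass κ]

/-- The conditional probability is finitely additive over the values of a finite map. -/
lemma condProb_inter_sum [IsFiniteMeasure μ] {S : Set Ω} (hS : MeasurableSet S) {η : Ω → κ}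
    (hη : Measurable η) :
    condProb μ m S =ᵐ[μ] fun x => ∑ j, condProb μ m (S ∩ η ⁻¹' {j}) x := by
  have h : S.indicator (fun _ => (1 : ℝ)) =
      ∑ j, (S ∩ η ⁻¹' {j}).indicator (fun _ => (1 : ℝ)) := by
    classical
    ext x
    rw [Finset.sum_apply, Finset.sum_eq_single (η x)]
    · simp [Set.indicator]
    · intro j _ hj
      exact Set.indicator_of_notMem (fun h => hj h.2.symm) _
    · simp
  unfold condProb
  rw [h]
  refine (condExp_finsetSum (fun j _ => integrable_indicator_one
    (hS.inter (hη (measurableSet_singleton j)))) m).trans (ae_of_all _ fun x => ?_)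
  simp [Finset.sum_apply]

/-- A coarser finite partition has smaller conditional entropy. -/
lemma finiteCondEntropy_mono [IsProbabilityMeasure μ] (hm : m ≤ mΩ) {ξ : Ω → ι} {η : Ω → κ}
    (hξ : Measurable ξ) (hη : Measurable η) (h : ∀ x y, η x = η y → ξ x = ξ y) :
    finiteCondEntropy μ m ξ ≤ finiteCondEntropy μ m η := by
  classical
  have hξi := fun i => hξ (measurableSet_singleton i)
  have hηj := fun j => hη (measurableSet_singleton j)
  have hint : ∀ i j, Integrable
      (fun x => Real.negMulLog (condProb μ m (ξ ⁻¹' {i} ∩ η ⁻¹' {j}) x)) μ :=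
    fun i j => integrable_negMulLog_condProb hm ((hξi i).inter (hηj j))
  have h1 : finiteCondEntropy μ m ξ ≤
      ∑ i, ∑ j, ∫ x, Real.negMulLog (condProb μ m (ξ ⁻¹' {i} ∩ η ⁻¹' {j}) x) ∂μ := by
    refine Finset.sum_le_sum fun i _ => ?_
    rw [← integral_finsetSum _ fun j _ => hint i j]
    refine integral_mono_ae (integrable_negMulLog_condProb hm (hξi i))
      (integrable_finsetSum _ fun j _ => hint i j) ?_
    filter_upwards [condProb_inter_sum (m := m) (μ := μ) (hξi i) hη,
      ae_all_iff.2 fun j => condProb_nonneg (μ := μ) (m := m) (ξ ⁻¹' {i} ∩ η ⁻¹' {j})]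
      with x hx h0
    rw [hx]
    exact negMulLog_sum_le _ _ fun j _ => h0 j
  refine h1.trans ?_
  rw [Finset.sum_comm]
  refine Finset.sum_le_sum fun j _ => le_of_eq ?_
  -- every level set of `η` lies in a single level set of `ξ`
  have h0 : ∀ i, ξ ⁻¹' {i} ∩ η ⁻¹' {j} = ∅ →
      ∫ x, Real.negMulLog (condProb μ m (ξ ⁻¹' {i} ∩ η ⁻¹' {j}) x) ∂μ = 0 := by
    intro i hi
    rw [hi]
    simp [condProb_empty]
  by_cases hj : ∃ y, η y = j
  · obtain ⟨y, rfl⟩ := hj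
    rw [Finset.sum_eq_single (ξ y)]
    · have hsub : η ⁻¹' {η y} ⊆ ξ ⁻¹' {ξ y} := fun x hx => h x y hx
      rw [Set.inter_eq_right.2 hsub]
    · intro i _ hi
      refine h0 i (Set.eq_empty_of_forall_notMem fun x hx => hi ?_)
      rw [← h x y hx.2]
      exact hx.1.symm
    · simp
  · have he : η ⁻¹' {j} = ∅ := Set.eq_empty_of_forall_notMem fun x hx => hj ⟨x, hx⟩
    rw [Finset.sum_eq_zero fun i _ => h0 i (by simp [he])]
    simp [he, condProb_empty]

lemma finiteCondEntropy_congr_level [IsProbabilityMeasure μ] (hm : m ≤ mΩ) {ξ : Ω → ι} {η : Ω → κ}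
    (hξ : Measurable ξ) (hη : Measurable η) (h : ∀ x y, η x = η y ↔ ξ x = ξ y) :
    finiteCondEntropy μ m ξ = finiteCondEntropy μ m η :=
  le_antisymm (finiteCondEntropy_mono hm hξ hη fun x y => (h x y).1)
    (finiteCondEntropy_mono hm hη hξ fun x y => (h x y).2)

/-- `m` is contained in `m'` modulo null sets. -/
def AELe (μ : Measure Ω) (m m' : MeasurableSpace Ω) : Prop :=
  ∀ S, MeasurableSet[m] S → ∃ S', MeasurableSet[m'] S' ∧ S =ᵐ[μ] S'

lemma AELe.of_le (h : m ≤ m') : AELe μ m m' := fun S hS => ⟨S, h S hS, ae_eq_refl _⟩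

/-- Enlarging the σ-algebra modulo null sets decreases the conditional entropy (Jensen). -/
lemma finiteCondEntropy_anti [IsProbabilityMeasure μ] (hm : m ≤ mΩ) (hm' : m' ≤ mΩ)
    (h : AELe μ m m') {ξ : Ω → ι} (hξ : Measurable ξ) :
    finiteCondEntropy μ m' ξ ≤ finiteCondEntropy μ m ξ := by
  refine Finset.sum_le_sum fun i _ => ?_
  set S := ξ ⁻¹' {i}
  have hS : MeasurableSet S := hξ (measurableSet_singleton i)
  set f := condProb μ m' S with hf
  -- the tower property
  have htower : μ[f | m] =ᵐ[μ] condProb μ m S := by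
    refine ae_eq_condExp_of_forall_setIntegral_eq hm (integrable_indicator_one hS)
      (fun s _ _ => integrable_condExp.integrableOn) (fun s hs _ => ?_)
      stronglyMeasurable_condExp.aestronglyMeasurable
    obtain ⟨s', hs', hss'⟩ := h s hs
    rw [setIntegral_condExp hm integrable_condExp hs, setIntegral_congr_set hss',
      setIntegral_condExp hm' (integrable_indicator_one hS) hs', setIntegral_congr_set hss']
  have hfi := integrable_negMulLog_condProb (μ := μ) hm' hS
  have hJ := Real.concaveOn_negMulLog.condExp_map_le (μ := μ) hm
    (Real.continuous_negMulLog.continuousOn.upperSemicontinuousOn) (condProb_nonneg S)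
    isClosed_Ici (integrable_condExp (m := m') (μ := μ)) hfi
  calc ∫ x, Real.negMulLog (f x) ∂μ = ∫ x, (μ[Real.negMulLog ∘ f | m]) x ∂μ :=
        (integral_condExp hm).symm
    _ ≤ ∫ x, Real.negMulLog (condProb μ m S x) ∂μ := by
        refine integral_mono_ae integrable_condExp (integrable_negMulLog_condProb hm hS) ?_
        filter_upwards [hJ, htower] with x hx ht
        rw [← ht]
        exact hx

lemma finiteCondEntropy_congr_aeLe [IsProbabilityMeasure μ] (hm : m ≤ mΩ) (hm' : m' ≤ mΩ)
    (h : AELe μ m m') (h' : AELe μ m' m) {ξ : Ω → ι} (hξ : Measurable ξ) :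
    finiteCondEntropy μ m ξ = finiteCondEntropy μ m' ξ :=
  le_antisymm (finiteCondEntropy_anti hm' hm h' hξ) (finiteCondEntropy_anti hm hm' h hξ)

/-- A partition into sets which belong to `m` modulo null sets has no entropy given `m`. -/
lemma finiteCondEntropy_eq_zero {ι : Type*} [Fintype ι] [IsProbabilityMeasure μ] (hm : m ≤ mΩ)
    {ξ : Ω → ι}
    (h : ∀ i, ∃ S', MeasurableSet[m] S' ∧ ξ ⁻¹' {i} =ᵐ[μ] S') :
    finiteCondEntropy μ m ξ = 0 := by
  refine Finset.sum_eq_zero fun i _ => ?_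
  obtain ⟨S', hS', hSS'⟩ := h i
  have h1 : condProb μ m (ξ ⁻¹' {i}) =ᵐ[μ] S'.indicator (fun _ => (1 : ℝ)) := by
    refine (condExp_congr_ae (indicator_ae_eq_of_ae_eq_set hSS')).trans ?_
    rw [condExp_of_stronglyMeasurable hm (stronglyMeasurable_const.indicator hS')
      (integrable_indicator_one (hm _ hS'))]
  rw [integral_congr_ae (g := fun _ => (0 : ℝ)), integral_zero]
  filter_upwards [h1] with x hx
  rw [hx]
  by_cases hxS : x ∈ S' <;> simp [hxS]

end FiniteEntropy

/-! ### Chain rule, Lévy convergence and invariance -/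

section ChainRule

variable {Ω : Type*} {m mΩ : MeasurableSpace Ω} {μ : Measure Ω}
variable {ι κ : Type*} [Fintype ι] [Fintype κ] [MeasurableSpace ι] [MeasurableSpace κ]
  [MeasurableSingletonClass ι] [MeasurableSingletonClass κ]

/-- The averaging property of conditional probabilities against a bounded `m`-measurable
function. -/
lemma integral_indicator_mul_eq_condProb_mul [IsProbabilityMeasure μ] (hm : m ≤ mΩ) {T : Set Ω}
    (hT : MeasurableSet T) {r : Ω → ℝ} (hr : StronglyMeasurable[m] r)
    (hr1 : ∀ᵐ x ∂μ, ‖r x‖ ≤ 1) {s : Set Ω} (hs : MeasurableSet[m] s) :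
    ∫ x in s, r x * T.indicator (fun _ => (1 : ℝ)) x ∂μ = ∫ x in s, r x * condProb μ m T x ∂μ := by
  have hi := integrable_indicator_one (μ := μ) hT
  have h := condExp_stronglyMeasurable_mul_of_bound hm hr hi 1 hr1
  have hint : Integrable (r * T.indicator fun _ => (1 : ℝ)) μ :=
    hi.bdd_mul (hr.mono hm).aestronglyMeasurable hr1
  calc _ = ∫ x in s, (μ[r * T.indicator fun _ => (1 : ℝ) | m]) x ∂μ :=
        (setIntegral_condExp hm hint hs).symm
    _ = _ := setIntegral_congr_ae (hm s hs) (h.mono fun x hx _ => hx)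

/-- On each level set of `η`, the sets of `m ⊔ σ(η)` are traces of sets of `m`. -/
lemma exists_inter_eq_of_measurableSet_sup {κ : Type*} [MeasurableSpace κ]
    {η : Ω → κ} {S : Set Ω} (hS : MeasurableSet[m ⊔ MeasurableSpace.comap η inferInstance] S)
    (j : κ) : ∃ s, MeasurableSet[m] s ∧ S ∩ η ⁻¹' {j} = s ∩ η ⁻¹' {j} := by
  have hle : m ⊔ MeasurableSpace.comap η inferInstance ≤
      (MeasurableSpace.comap (Subtype.val : η ⁻¹' {j} → Ω) m).map Subtype.val := by
    refine sup_le (fun s hs => ⟨s, hs, rfl⟩) ?_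
    rintro _ ⟨T, -, rfl⟩
    by_cases hj : j ∈ T
    · refine ⟨Set.univ, MeasurableSet.univ, ?_⟩
      ext ⟨x, hx⟩
      have hx' : η x = j := hx
      simp [hx', hj]
    · refine ⟨∅, @MeasurableSet.empty _ m, ?_⟩
      ext ⟨x, hx⟩
      have hx' : η x = j := hx
      simp [hx', hj]
  obtain ⟨s, hs, h⟩ := hle S hS
  refine ⟨s, hs, ?_⟩
  rw [Set.inter_comm, Set.inter_comm s]
  exact (Subtype.preimage_val_eq_preimage_val_iff _ _ _).1 h.symm

/-- Given `m ⊔ σ(η)`, the conditional probability of `S` on `{η = j}` is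
`μ(S ∩ {η = j} | m) / μ(η = j | m)`. -/
lemma condProb_sup_comap [IsProbabilityMeasure μ] (hm : m ≤ mΩ) {S : Set Ω}
    (hS : MeasurableSet S) {η : Ω → κ} (hη : Measurable η) :
    condProb μ (m ⊔ MeasurableSpace.comap η inferInstance) S =ᵐ[μ] fun x =>
      ∑ j, condProb μ m (S ∩ η ⁻¹' {j}) x / condProb μ m (η ⁻¹' {j}) x *
        (η ⁻¹' {j}).indicator (fun _ => (1 : ℝ)) x := by
  have hηj := fun j => hη (measurableSet_singleton j)
  have hm' : m ⊔ MeasurableSpace.comap η inferInstance ≤ mΩ := sup_le hm hη.comap_le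
  set r : κ → Ω → ℝ := fun j x => condProb μ m (S ∩ η ⁻¹' {j}) x / condProb μ m (η ⁻¹' {j}) x
    with hr
  have hrm : ∀ j, StronglyMeasurable[m] (r j) := fun j =>
    (stronglyMeasurable_condExp.measurable.div
      stronglyMeasurable_condExp.measurable).stronglyMeasurable
  have hrb : ∀ j, ∀ᵐ x ∂μ, ‖r j x‖ ≤ 1 := by
    intro j
    filter_upwards [condProb_nonneg (μ := μ) (m := m) (S ∩ η ⁻¹' {j}),
      condProb_nonneg (μ := μ) (m := m) (η ⁻¹' {j}), condProb_mono (μ := μ) (m := m)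
        (hS.inter (hηj j)) (hηj j) Set.inter_subset_right] with x h0 h1 h2
    rw [Real.norm_of_nonneg (div_nonneg h0 h1)]
    exact div_le_one_of_le₀ h2 h1
  have hint : ∀ j, Integrable
      (fun x => r j x * (η ⁻¹' {j}).indicator (fun _ => (1 : ℝ)) x) μ := fun j =>
    (integrable_indicator_one (hηj j)).bdd_mul ((hrm j).mono hm).aestronglyMeasurable (hrb j)
  symm
  refine ae_eq_condExp_of_forall_setIntegral_eq hm' (integrable_indicator_one hS)
    (fun s _ _ => (integrable_finsetSum _ fun j _ => hint j).integrableOn) (fun s hs _ => ?_) ?_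
  · have hsΩ := hm' s hs
    rw [integral_finsetSum _ fun j _ => (hint j).integrableOn]
    have hsplit : ∫ x in s, S.indicator (fun _ => (1 : ℝ)) x ∂μ =
        ∑ j, ∫ x in s ∩ η ⁻¹' {j}, S.indicator (fun _ => (1 : ℝ)) x ∂μ := by
      have : s = ⋃ j, s ∩ η ⁻¹' {j} := by ext x; simp
      conv_lhs => rw [this]
      refine integral_iUnion_fintype (fun j => hsΩ.inter (hηj j)) ?_
        fun j => (integrable_indicator_one hS).integrableOn
      intro i j hij
      exact Set.disjoint_left.2 fun x hi hj => hij (hi.2.symm.trans hj.2)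
    rw [hsplit]
    refine Finset.sum_congr rfl fun j _ => ?_
    obtain ⟨t, ht, hst⟩ := exists_inter_eq_of_measurableSet_sup hs j
    have htΩ := hm t ht
    -- replace `s` by `t`, which is allowed on `{η = j}`
    have h1 : ∫ x in s, r j x * (η ⁻¹' {j}).indicator (fun _ => (1 : ℝ)) x ∂μ =
        ∫ x in t, r j x * (η ⁻¹' {j}).indicator (fun _ => (1 : ℝ)) x ∂μ := by
      rw [← integral_indicator hsΩ, ← integral_indicator htΩ]
      congr 1
      ext x
      by_cases hx : x ∈ η ⁻¹' {j}
      · have : x ∈ s ↔ x ∈ t := by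
          have := Set.ext_iff.1 hst x
          exact ⟨fun h => (this.1 ⟨h, hx⟩).1, fun h => (this.2 ⟨h, hx⟩).1⟩
        by_cases hxs : x ∈ s
        · rw [Set.indicator_of_mem hxs, Set.indicator_of_mem (this.1 hxs)]
        · rw [Set.indicator_of_notMem hxs, Set.indicator_of_notMem (mt this.2 hxs)]
      · rw [Set.indicator_apply_eq_zero.2 fun _ => by simp [hx],
          Set.indicator_apply_eq_zero.2 fun _ => by simp [hx]]
    rw [h1, integral_indicator_mul_eq_condProb_mul hm (hηj j) (hrm j) (hrb j) ht, hst]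
    have h2 : ∫ x in t, r j x * condProb μ m (η ⁻¹' {j}) x ∂μ =
        ∫ x in t, condProb μ m (S ∩ η ⁻¹' {j}) x ∂μ := by
      refine setIntegral_congr_ae htΩ ?_
      filter_upwards [condProb_nonneg (μ := μ) (m := m) (S ∩ η ⁻¹' {j}),
        condProb_mono (μ := μ) (m := m) (hS.inter (hηj j)) (hηj j) Set.inter_subset_right]
        with x h0 h2 _
      by_cases hz : condProb μ m (η ⁻¹' {j}) x = 0
      · rw [hz] at h2
        rw [hz, mul_zero]
        linarith
      · exact div_mul_cancel₀ _ hz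
    rw [h2, setIntegral_condExp hm (integrable_indicator_one (hS.inter (hηj j))) ht,
      ← integral_indicator htΩ, ← integral_indicator (htΩ.inter (hηj j)),
      Set.indicator_indicator, Set.indicator_indicator, Set.inter_assoc,
      Set.inter_comm (η ⁻¹' {j})]
  · have hcm : m ≤ m ⊔ MeasurableSpace.comap η inferInstance := le_sup_left
    refine StronglyMeasurable.aestronglyMeasurable ?_
    refine Finset.stronglyMeasurable_fun_sum _ fun j _ => ((hrm j).mono hcm).mul ?_
    refine stronglyMeasurable_const.indicator ?_
    have : MeasurableSpace.comap η inferInstance ≤ m ⊔ MeasurableSpace.comap η inferInstance :=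
      le_sup_right
    exact this _ ⟨{j}, measurableSet_singleton j, rfl⟩

/-- The chain rule `H(ξ ∨ η | m) = H(η | m) + H(ξ | m ⊔ σ(η))`. -/
theorem finiteCondEntropy_prod [IsProbabilityMeasure μ] (hm : m ≤ mΩ) {ξ : Ω → ι} {η : Ω → κ}
    (hξ : Measurable ξ) (hη : Measurable η) :
    finiteCondEntropy μ m (fun x => (ξ x, η x)) = finiteCondEntropy μ m η +
      finiteCondEntropy μ (m ⊔ MeasurableSpace.comap η inferInstance) ξ := by
  have hξi := fun i => hξ (measurableSet_singleton i)
  have hηj := fun j => hη (measurableSet_singleton j)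
  have hset : ∀ i j, (fun x => (ξ x, η x)) ⁻¹' {(i, j)} = ξ ⁻¹' {i} ∩ η ⁻¹' {j} := by
    intro i j
    ext x
    simp [Prod.ext_iff]
  set p : ι → κ → Ω → ℝ := fun i j => condProb μ m (ξ ⁻¹' {i} ∩ η ⁻¹' {j}) with hp
  set q : κ → Ω → ℝ := fun j => condProb μ m (η ⁻¹' {j}) with hq
  have hp0 : ∀ i j, ∀ᵐ x ∂μ, 0 ≤ p i j x := fun i j => condProb_nonneg _
  have hq0 : ∀ j, ∀ᵐ x ∂μ, 0 ≤ q j x := fun j => condProb_nonneg _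
  have hpq : ∀ i j, ∀ᵐ x ∂μ, p i j x ≤ q j x := fun i j =>
    condProb_mono ((hξi i).inter (hηj j)) (hηj j) Set.inter_subset_right
  have hpint : ∀ i j, Integrable (fun x => Real.negMulLog (p i j x)) μ := fun i j =>
    integrable_negMulLog_condProb hm ((hξi i).inter (hηj j))
  have hqint : ∀ j, Integrable (fun x => Real.negMulLog (q j x)) μ := fun j =>
    integrable_negMulLog_condProb hm (hηj j)
  have hrm : ∀ i j, StronglyMeasurable[m] (fun x => Real.negMulLog (p i j x / q j x)) := by
    intro i j
    exact Real.continuous_negMulLog.comp_stronglyMeasurable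
      (stronglyMeasurable_condExp.measurable.div
        stronglyMeasurable_condExp.measurable).stronglyMeasurable
  have hrb : ∀ i j, ∀ᵐ x ∂μ, ‖Real.negMulLog (p i j x / q j x)‖ ≤ 1 := by
    intro i j
    filter_upwards [hp0 i j, hq0 j, hpq i j] with x h0 h1 h2
    have := div_nonneg h0 h1
    rw [Real.norm_of_nonneg (Real.negMulLog_nonneg this (div_le_one_of_le₀ h2 h1))]
    exact negMulLog_le_one this
  have hcond : finiteCondEntropy μ (m ⊔ MeasurableSpace.comap η inferInstance) ξ =
      ∑ i, ∑ j, ∫ x, Real.negMulLog (p i j x / q j x) * q j x ∂μ := by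
    refine Finset.sum_congr rfl fun i _ => ?_
    have h1 : ∀ᵐ x ∂μ, Real.negMulLog (condProb μ
        (m ⊔ MeasurableSpace.comap η inferInstance) (ξ ⁻¹' {i}) x) =
        ∑ j, Real.negMulLog (p i j x / q j x) * (η ⁻¹' {j}).indicator (fun _ => (1 : ℝ)) x := by
      filter_upwards [condProb_sup_comap hm (hξi i) hη] with x hx
      rw [hx, Finset.sum_eq_single (η x), Finset.sum_eq_single (η x)]
      · simp [hp, hq]
      · intro j _ hj
        simp [hj.symm]
      · simp
      · intro j _ hj
        simp [hj.symm]
      · simp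
    rw [integral_congr_ae h1, integral_finsetSum _ fun j _ =>
      (integrable_indicator_one (hηj j)).bdd_mul ((hrm i j).mono hm).aestronglyMeasurable
        (hrb i j)]
    refine Finset.sum_congr rfl fun j _ => ?_
    have := integral_indicator_mul_eq_condProb_mul hm (hηj j) (hrm i j) (hrb i j)
      (s := Set.univ) MeasurableSet.univ
    simpa only [Measure.restrict_univ] using this
  have hjoint : finiteCondEntropy μ m (fun x => (ξ x, η x)) =
      ∑ i, ∑ j, ∫ x, Real.negMulLog (p i j x) ∂μ := by
    rw [finiteCondEntropy, Fintype.sum_prod_type]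
    simp only [hset, hp]
  rw [hcond, hjoint, Finset.sum_comm, Finset.sum_comm (s := (Finset.univ : Finset ι)),
    finiteCondEntropy, ← Finset.sum_add_distrib]
  refine Finset.sum_congr rfl fun j _ => ?_
  have hrint : ∀ i, Integrable (fun x => Real.negMulLog (p i j x / q j x) * q j x) μ := fun i =>
    integrable_condExp.bdd_mul ((hrm i j).mono hm).aestronglyMeasurable (hrb i j)
  rw [← integral_finsetSum _ fun i _ => hpint i j, ← integral_finsetSum _ fun i _ => hrint i,
    ← integral_add (hqint j) (integrable_finsetSum _ fun i _ => hrint i)]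
  refine integral_congr_ae ?_
  have hsum : ∀ᵐ x ∂μ, q j x = ∑ i, p i j x := by
    filter_upwards [condProb_inter_sum (m := m) (μ := μ) (hηj j) hξ] with x hx
    refine hx.trans ?_
    exact Finset.sum_congr rfl fun i _ => by rw [hp, Set.inter_comm]
  filter_upwards [hsum, ae_all_iff.2 fun i => hp0 i j, ae_all_iff.2 fun i => hpq i j]
    with x hs h0 h1
  have key : ∀ i, Real.negMulLog (p i j x / q j x) * q j x =
      Real.negMulLog (p i j x) + p i j x * Real.log (q j x) := by
    intro i
    rcases (h0 i).eq_or_lt with hz | hpos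
    · simp [← hz]
    have hqpos := hpos.trans_le (h1 i)
    rw [Real.negMulLog, Real.negMulLog, Real.log_div hpos.ne' hqpos.ne']
    field_simp
    ring
  simp only [key, Finset.sum_add_distrib, ← Finset.sum_mul]
  rw [← hs, Real.negMulLog]
  ring

/-- Lévy's upward theorem for conditional entropies. -/
theorem tendsto_finiteCondEntropy [IsProbabilityMeasure μ] (ℱ : Filtration ℕ mΩ) {ξ : Ω → ι}
    (hξ : Measurable ξ) :
    Tendsto (fun n => finiteCondEntropy μ (ℱ n) ξ) atTop
      (𝓝 (finiteCondEntropy μ (⨆ n, ℱ n) ξ)) := by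
  refine tendsto_finsetSum _ fun i _ => ?_
  have hS := hξ (measurableSet_singleton i)
  refine tendsto_integral_of_dominated_convergence (fun _ => (1 : ℝ))
    (fun n => (integrable_negMulLog_condProb (ℱ.le n) hS).aestronglyMeasurable)
    (integrable_const _) (fun n => ?_) ?_
  · filter_upwards [condProb_nonneg (μ := μ) (m := ℱ n) (ξ ⁻¹' {i}),
      condProb_le_one (ℱ.le n) hS] with x h0 h1
    rw [Real.norm_of_nonneg (Real.negMulLog_nonneg h0 h1)]
    exact negMulLog_le_one h0
  · filter_upwards [tendsto_ae_condExp (μ := μ) (ℱ := ℱ)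
      ((ξ ⁻¹' {i}).indicator fun _ => (1 : ℝ))] with x hx
    exact (Real.continuous_negMulLog.tendsto _).comp hx

lemma condProb_comap [IsProbabilityMeasure μ] (hm : m ≤ mΩ) {T : Ω → Ω}
    (hT : MeasurePreserving T μ μ) {S : Set Ω} (hS : MeasurableSet S) :
    condProb μ (m.comap T) (T ⁻¹' S) =ᵐ[μ] condProb μ m S ∘ T := by
  have hm' : m.comap T ≤ mΩ :=
    (MeasurableSpace.comap_mono hm).trans hT.measurable.comap_le
  have hint : Integrable (condProb μ m S ∘ T) μ :=
    hT.integrable_comp_of_integrable integrable_condExp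
  symm
  refine ae_eq_condExp_of_forall_setIntegral_eq hm' (integrable_indicator_one (hT.measurable hS))
    (fun s _ _ => hint.integrableOn) ?_ ?_
  · rintro _ ⟨s, hs, rfl⟩ -
    have h1 : ∀ f : Ω → ℝ, AEStronglyMeasurable f μ →
        ∫ x in T ⁻¹' s, f (T x) ∂μ = ∫ x in s, f x ∂μ := by
      intro f hf
      conv_rhs => rw [← hT.map_eq]
      rw [setIntegral_map (hm s hs) (by rwa [hT.map_eq]) hT.measurable.aemeasurable]
    have h2 := h1 _ (integrable_indicator_one (μ := μ) hS).aestronglyMeasurable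
    refine (h1 _ integrable_condExp.aestronglyMeasurable).trans ?_
    rw [setIntegral_condExp hm (integrable_indicator_one hS) hs, ← h2]
    rfl
  · have h : @Measurable Ω Ω (m.comap T) m T := comap_measurable T
    exact (StronglyMeasurable.comp_measurable stronglyMeasurable_condExp h).aestronglyMeasurable

/-- Conditional entropy is invariant under measure-preserving maps. -/
lemma finiteCondEntropy_comap [IsProbabilityMeasure μ] (hm : m ≤ mΩ) {T : Ω → Ω}
    (hT : MeasurePreserving T μ μ) {ξ : Ω → ι} (hξ : Measurable ξ) :
    finiteCondEntropy μ (m.comap T) (ξ ∘ T) = finiteCondEntropy μ m ξ := by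
  refine Finset.sum_congr rfl fun i _ => ?_
  have hS := hξ (measurableSet_singleton i)
  rw [Set.preimage_comp]
  calc _ = ∫ x, Real.negMulLog (condProb μ m (ξ ⁻¹' {i}) (T x)) ∂μ := by
        refine integral_congr_ae ?_
        filter_upwards [condProb_comap hm hT hS] with x hx
        rw [hx]
        rfl
    _ = _ := by
        have h : ∀ f : Ω → ℝ, AEStronglyMeasurable f μ → ∫ x, f (T x) ∂μ = ∫ x, f x ∂μ := by
          intro f hf
          conv_rhs => rw [← hT.map_eq]
          rw [integral_map hT.measurable.aemeasurable (by rwa [hT.map_eq])]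
        exact h _ (integrable_negMulLog_condProb hm hS).aestronglyMeasurable

end ChainRule

/-! ### Entropy through the information function -/

section InformationFunction

/-- The extended function `p ↦ -log p` on `[0, ∞]`, with `-log 0 = ∞`; it vanishes for `p ≥ 1`. -/
def negLog (p : ℝ≥0∞) : ℝ≥0∞ := (-ENNReal.log p).toENNReal

lemma continuous_negLog : Continuous negLog :=
  EReal.continuous_toENNReal.comp (continuous_neg.comp ENNReal.continuous_log)

lemma negLog_antitone : Antitone negLog := fun _ _ h =>
  EReal.toENNReal_le_toENNReal (EReal.neg_le_neg_iff.2 (ENNReal.log_monotone h))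

lemma negLog_zero : negLog 0 = ⊤ := by simp [negLog]

lemma negLog_mul_self {p : ℝ≥0∞} (hp : p ≤ 1) :
    negLog p * p = ENNReal.ofReal (Real.negMulLog p.toReal) := by
  rcases eq_or_ne p 0 with rfl | h0
  · simp
  have htop : p ≠ ⊤ := (hp.trans_lt ENNReal.one_lt_top).ne
  have h1 : p.toReal ≤ 1 := by simpa using ENNReal.toReal_mono ENNReal.one_ne_top hp
  have hlog : 0 ≤ -Real.log p.toReal :=
    neg_nonneg.2 (Real.log_nonpos ENNReal.toReal_nonneg h1)
  have h2 : negLog p = ENNReal.ofReal (-Real.log p.toReal) := by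
    rw [negLog, ENNReal.log_pos_real h0 htop, ← EReal.coe_neg, EReal.toENNReal_of_ne_top (by simp)]
    simp
  rw [h2]
  conv_lhs => rw [← ENNReal.ofReal_toReal htop]
  rw [ENNReal.toReal_ofReal ENNReal.toReal_nonneg, ← ENNReal.ofReal_mul hlog, Real.negMulLog]
  congr 1
  ring

variable {Y : Type*} [MeasurableSpace Y] {ν : Measure Y}

/-- The entropy of a finite partition is the integral of its information function. -/
lemma sum_negMulLog_eq_lintegral [IsProbabilityMeasure ν] {ι : Type*} [Fintype ι]
    [MeasurableSpace ι] [MeasurableSingletonClass ι] {ξ : Y → ι} (hξ : Measurable ξ) :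
    ∑ i, ENNReal.ofReal (Real.negMulLog (ν (ξ ⁻¹' {i})).toReal) =
      ∫⁻ y, negLog (ν (ξ ⁻¹' {ξ y})) ∂ν := by
  have h := lintegral_map (μ := ν) (f := fun i => negLog (ν (ξ ⁻¹' {i})))
    (measurable_of_countable _) hξ
  rw [← h, lintegral_fintype]
  refine Finset.sum_congr rfl fun i _ => ?_
  rw [Measure.map_apply hξ (measurableSet_singleton i), negLog_mul_self prob_le_one]

/-- The entropy of a partition is the integral of its information function `-log ν([y])`, provided
that its elements and this function are measurable. -/
lemma partitionEntropy_eq_lintegral [IsProbabilityMeasure ν] {γ : Setoid Y}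
    (hcls : ∀ y, MeasurableSet {z | γ y z}) (hmeas : Measurable fun y => ν {z | γ y z}) :
    partitionEntropy ν γ = ∫⁻ y, negLog (ν {z | γ y z}) ∂ν := by
  have hcls' : ∀ y, {z | Quotient.mk γ z = Quotient.mk γ y} = {z | γ y z} := by
    intro y
    ext z
    exact ⟨fun h => γ.symm (Quotient.exact h), fun h => Quotient.sound (γ.symm h)⟩
  unfold partitionEntropy
  split_ifs with h
  · set c : Quotient γ → Set Y := fun q => {z | Quotient.mk γ z = q} with hc
    have hcm : ∀ q, MeasurableSet (c q) := by
      intro q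
      obtain ⟨y, rfl⟩ := Quotient.exists_rep q
      simp only [hc]
      erw [hcls' y]
      exact hcls y
    have hdisj : Pairwise (Function.onFun Disjoint c) := fun p q hpq =>
      Set.disjoint_left.2 fun z hp hq => hpq (hp.symm.trans hq)
    set Q : Set (Quotient γ) := {q | 0 < ν (c q)} with hQ
    have hQc : Q.Countable := Measure.countable_meas_pos_of_disjoint_iUnion hcm hdisj
    have hcover : (⋃ q ∈ Q, c q) =ᵐ[ν] Set.univ := by
      rw [ae_eq_univ]
      refine measure_mono_null (fun y hy => ?_) h
      by_contra hne
      refine hy (Set.mem_biUnion (x := Quotient.mk γ y) ?_ rfl)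
      have : 0 < ν {z | Quotient.mk γ z = Quotient.mk γ y} := by
        rw [hcls' y]
        exact pos_iff_ne_zero.2 hne
      exact this
    rw [← setLIntegral_univ, ← setLIntegral_congr hcover,
      lintegral_biUnion hQc (fun q _ => hcm q) (fun p _ q _ hpq => hdisj hpq)]
    have hterm : ∀ q, ∫⁻ y in c q, negLog (ν {z | γ y z}) ∂ν =
        ENNReal.ofReal (Real.negMulLog (ν (c q)).toReal) := by
      intro q
      have : ∀ y ∈ c q, negLog (ν {z | γ y z}) = negLog (ν (c q)) := by
        rintro y rfl
        rw [← hcls' y]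
      rw [setLIntegral_congr_fun (hcm q) this, setLIntegral_const, negLog_mul_self prob_le_one]
    simp only [hterm]
    symm
    refine tsum_subtype_eq_of_support_subset (f := fun q =>
      ENNReal.ofReal (Real.negMulLog (ν (c q)).toReal)) fun q hq => ?_
    by_contra hq0
    have : ν (c q) = 0 := by simpa [hQ] using hq0
    simp [this] at hq
  · symm
    refine lintegral_eq_top_of_measure_eq_top_ne_zero
      (continuous_negLog.measurable.comp hmeas).aemeasurable fun h0 => h (measure_mono_null ?_ h0)
    intro y hy
    have hy' : ν {z | γ y z} = 0 := hy
    simp [hy', negLog_zero]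

/-- The entropy of a partition is the supremum of the entropies of finite partitions which
increase to it. -/
lemma partitionEntropy_eq_iSup [IsProbabilityMeasure ν] {ι : ℕ → Type*} [∀ n, Fintype (ι n)]
    [∀ n, MeasurableSpace (ι n)] [∀ n, MeasurableSingletonClass (ι n)] {ξ : ∀ n, Y → ι n}
    (hξ : ∀ n, Measurable (ξ n))
    (hmono : ∀ n x y, ξ (n + 1) x = ξ (n + 1) y → ξ n x = ξ n y) {γ : Setoid Y}
    (hγ : ∀ x y, γ x y ↔ ∀ n, ξ n x = ξ n y) :
    partitionEntropy ν γ =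
      ⨆ n, ∑ i, ENNReal.ofReal (Real.negMulLog (ν (ξ n ⁻¹' {i})).toReal) := by
  have hanti : ∀ y, Antitone fun n => ξ n ⁻¹' {ξ n y} := fun y =>
    antitone_nat_of_succ_le fun n x hx => hmono n x y hx
  have hcls : ∀ y, {z | γ y z} = ⋂ n, ξ n ⁻¹' {ξ n y} := by
    intro y
    ext z
    simp only [Set.mem_iInter, Set.mem_preimage, Set.mem_singleton_iff, Set.mem_ofPred_eq, hγ]
    exact forall_congr' fun n => eq_comm
  have hm : ∀ n y, MeasurableSet (ξ n ⁻¹' {ξ n y}) := fun n y =>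
    hξ n (measurableSet_singleton _)
  have hlim : ∀ y, Tendsto (fun n => ν (ξ n ⁻¹' {ξ n y})) atTop (𝓝 (ν {z | γ y z})) := by
    intro y
    rw [hcls]
    exact tendsto_measure_iInter_atTop (fun n => (hm n y).nullMeasurableSet) (hanti y)
      ⟨0, measure_ne_top _ _⟩
  have hfm : ∀ n, Measurable fun y => ν (ξ n ⁻¹' {ξ n y}) := fun n =>
    (measurable_of_countable fun i => ν (ξ n ⁻¹' {i})).comp (hξ n)
  rw [partitionEntropy_eq_lintegral
    (fun y => by rw [hcls]; exact MeasurableSet.iInter fun n => hm n y)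
    (measurable_of_tendsto_metrizable hfm (tendsto_pi_nhds.2 hlim))]
  simp only [sum_negMulLog_eq_lintegral (hξ _)]
  have hmon : ∀ y, Monotone fun n => negLog (ν (ξ n ⁻¹' {ξ n y})) := fun y k n hkn =>
    negLog_antitone (measure_mono (hanti y hkn))
  have hsup := lintegral_iSup (μ := ν) (f := fun n y => negLog (ν (ξ n ⁻¹' {ξ n y})))
    (fun n => continuous_negLog.measurable.comp (hfm n)) fun k n hkn y => hmon y hkn
  rw [← hsup]
  refine lintegral_congr fun y => ?_
  exact tendsto_nhds_unique ((continuous_negLog.tendsto _).comp (hlim y))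
    (tendsto_atTop_iSup (hmon y))

end InformationFunction

/-! ### Canonical systems and conditional probabilities -/

section CanonicalSystem

variable {X : Type*} [B : MeasurableSpace X] {μ : Measure X}

/-- The σ-algebra of the measurable `β`-sets, as the preimage of the quotient σ-algebra. -/
@[reducible] def partitionSigma (β : Setoid X) : MeasurableSpace X :=
  MeasurableSpace.comap (Quotient.mk β) inferInstance

lemma partitionSigma_le (β : Setoid X) : partitionSigma β ≤ B :=
  (measurable_quotient_mk'' : Measurable (Quotient.mk β)).comap_le

lemma measurableSet_partitionSigma_iff {β : Setoid X} {S : Set X} :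
    MeasurableSet[partitionSigma β] S ↔ MeasurableSet S ∧ IsPartitionSet β S := by
  constructor
  · intro h
    refine ⟨partitionSigma_le β S h, ?_⟩
    obtain ⟨T, -, rfl⟩ := h
    intro x y hxy hx
    have : Quotient.mk β x = Quotient.mk β y := Quotient.sound hxy
    simpa [← this] using hx
  · rintro ⟨hS, hβ⟩
    have h : Quotient.mk β ⁻¹' (Quotient.mk β '' S) = S := by
      refine Set.Subset.antisymm ?_ (Set.subset_preimage_image _ _)
      rintro x ⟨y, hy, hyx⟩
      exact hβ y x (Quotient.exact hyx) hy
    refine ⟨Quotient.mk β '' S, ?_, h⟩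
    change MeasurableSet (Quotient.mk β ⁻¹' (Quotient.mk β '' S))
    rwa [h]

/-- The trace of `S` on the element `b` of `β`. -/
abbrev fiberTrace (β : Setoid X) (b : Quotient β) (S : Set X) : Set (PartitionFiber β b) :=
  (Subtype.val : PartitionFiber β b → X) ⁻¹' S

lemma measurable_quotientMk (β : Setoid X) : Measurable (Quotient.mk β) :=
  measurable_quotient_mk''

variable {β : Setoid X}

/-- The conditional measures of a canonical system represent the conditional probabilities given
the σ-algebra of measurable `β`-sets. -/
lemma CanonicalSystem.toReal_meas_ae_eq_condProb [IsProbabilityMeasure μ]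
    (D : CanonicalSystem μ β) {S : Set X} (hS : MeasurableSet S) :
    (fun x => (D.meas (Quotient.mk β x) (fiberTrace β (Quotient.mk β x) S)).toReal) =ᵐ[μ]
      condProb μ (partitionSigma β) S := by
  have hmk := measurable_quotientMk β
  have hfin : ∀ T : Set X, MeasurableSet T →
      ∫⁻ x, D.meas (Quotient.mk β x) (fiberTrace β (Quotient.mk β x) T) ∂μ = μ T := by
    intro T hT
    rw [D.lintegral_meas T hT, factorMeasure, lintegral_map (D.measurable_meas T hT) hmk]
  have hmeas : Measurable
      fun x => D.meas (Quotient.mk β x) (fiberTrace β (Quotient.mk β x) S) :=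
    (D.measurable_meas S hS).comp hmk
  have hlt : ∀ᵐ x ∂μ, D.meas (Quotient.mk β x) (fiberTrace β (Quotient.mk β x) S) < ⊤ :=
    ae_lt_top hmeas (by rw [hfin S hS]; exact measure_ne_top _ _)
  have hint : Integrable
      (fun x => (D.meas (Quotient.mk β x) (fiberTrace β (Quotient.mk β x) S)).toReal) μ :=
    integrable_toReal_of_lintegral_ne_top hmeas.aemeasurable
      (by rw [hfin S hS]; exact measure_ne_top _ _)
  refine ae_eq_condExp_of_forall_setIntegral_eq (partitionSigma_le β)
    (integrable_indicator_one hS) (fun s _ _ => hint.integrableOn) (fun s hs _ => ?_) ?_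
  · obtain ⟨U, hU, rfl⟩ := hs
    have hsm : MeasurableSet (Quotient.mk β ⁻¹' U) := hmk hU
    rw [integral_toReal hmeas.aemeasurable (ae_restrict_of_ae hlt),
      setIntegral_indicator hS, setIntegral_const, smul_eq_mul, mul_one, measureReal_def,
      Set.inter_comm, ← hfin _ (hS.inter hsm), ← lintegral_indicator hsm]
    congr 1
    refine lintegral_congr fun x => ?_
    by_cases hx : Quotient.mk β x ∈ U
    · rw [Set.indicator_of_mem (by exact hx)]
      congr 1
      ext ⟨z, hz⟩
      simp [fiberTrace, hz, hx]
    · rw [Set.indicator_of_notMem (by exact hx)]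
      have : fiberTrace β (Quotient.mk β x) (S ∩ Quotient.mk β ⁻¹' U) = ∅ := by
        refine Set.eq_empty_of_forall_notMem ?_
        rintro ⟨z, hz⟩ ⟨-, hzU⟩
        exact hx (hz ▸ hzU)
      rw [this, measure_empty]
  · refine StronglyMeasurable.aestronglyMeasurable ?_
    have h1 : Measurable[partitionSigma β] (Quotient.mk β) := comap_measurable _
    exact ((D.measurable_meas S hS).ennreal_toReal.comp h1).stronglyMeasurable

variable {γ : Setoid X} {ι : ℕ → Type*} [∀ n, Fintype (ι n)] [∀ n, MeasurableSpace (ι n)]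
  [∀ n, MeasurableSingletonClass (ι n)] {ξ : ∀ n, X → ι n}

/-- The mean conditional entropy of a partition is the supremum of the conditional entropies of
finite partitions which increase to it. -/
theorem condEntropy_eq_iSup [IsProbabilityMeasure μ] (hβ : Nonempty (CanonicalSystem μ β))
    (hξ : ∀ n, Measurable (ξ n))
    (hmono : ∀ n x y, ξ (n + 1) x = ξ (n + 1) y → ξ n x = ξ n y)
    (hγ : ∀ x y, γ x y ↔ ∀ n, ξ n x = ξ n y) :
    condEntropy μ γ β =
      ⨆ n, ENNReal.ofReal (finiteCondEntropy μ (partitionSigma β) (ξ n)) := by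
  have hmk := measurable_quotientMk β
  rw [condEntropy, dif_pos hβ]
  set D := hβ.some
  set H : ∀ n, Quotient β → ℝ≥0∞ := fun n b => ∑ i, ENNReal.ofReal
    (Real.negMulLog (D.meas b (fiberTrace β b (ξ n ⁻¹' {i}))).toReal) with hH
  have hS : ∀ n i, MeasurableSet (ξ n ⁻¹' {i}) := fun n i => hξ n (measurableSet_singleton i)
  have hHm : ∀ n, Measurable (H n) := fun n => Finset.measurable_fun_sum _ fun i _ =>
    (Real.continuous_negMulLog.measurable.comp
      (D.measurable_meas _ (hS n i)).ennreal_toReal).ennreal_ofReal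
  have hfib : ∀ᵐ b ∂(factorMeasure μ β),
      (IsProbabilityMeasure (D.meas b)) ∧ ∀ n, @Measurable _ _ (D.sigma b) _
        (fun y : PartitionFiber β b => ξ n y.1) := by
    have h1 : ∀ᵐ b ∂(factorMeasure μ β), ∀ n i,
        MeasurableSet[D.sigma b] (fiberTrace β b (ξ n ⁻¹' {i})) :=
      ae_all_iff.2 fun n => ae_all_iff.2 fun i => D.measurableSet_trace _ (hS n i)
    filter_upwards [D.isLebesgueSpace, h1] with b hb h1
    refine ⟨@IsLebesgueSpace.isProbabilityMeasure _ (D.sigma b) _ hb, fun n => ?_⟩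
    let := D.sigma b
    exact measurable_to_countable' (h1 n)
  have hent : ∀ᵐ b ∂(factorMeasure μ β),
      @partitionEntropy (PartitionFiber β b) (D.sigma b) (D.meas b)
        (Setoid.comap Subtype.val γ) = ⨆ n, H n b := by
    filter_upwards [hfib] with b ⟨hp, hm⟩
    exact @partitionEntropy_eq_iSup _ (D.sigma b) (D.meas b) hp ι _ _ _
      (fun n y => ξ n y.1) hm (fun n x y h => hmono n _ _ h) _ fun x y => hγ x.1 y.1
  have hHmono : ∀ᵐ b ∂(factorMeasure μ β), Monotone fun n => H n b := by
    filter_upwards [hfib] with b ⟨hp, hm⟩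
    let := D.sigma b
    have hHi : ∀ n, H n b = ∫⁻ y : PartitionFiber β b, negLog (D.meas b
        ((fun y : PartitionFiber β b => ξ n y.1) ⁻¹' {ξ n y.1})) ∂(D.meas b) := fun n =>
      sum_negMulLog_eq_lintegral (hm n)
    refine monotone_nat_of_le_succ fun n => ?_
    rw [hHi, hHi]
    refine lintegral_mono fun y => negLog_antitone (measure_mono fun z hz => ?_)
    exact hmono n _ _ hz
  rw [lintegral_congr_ae hent, lintegral_iSup' (fun n => (hHm n).aemeasurable) hHmono]
  refine iSup_congr fun n => ?_
  rw [factorMeasure, lintegral_map (hHm n) hmk]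
  simp only [hH]
  have hterm : ∀ i, Measurable fun x => ENNReal.ofReal (Real.negMulLog
      (D.meas (Quotient.mk β x) (fiberTrace β (Quotient.mk β x) (ξ n ⁻¹' {i}))).toReal) :=
    fun i => ((Real.continuous_negMulLog.measurable.comp
      (D.measurable_meas _ (hS n i)).ennreal_toReal).ennreal_ofReal).comp hmk
  rw [lintegral_finsetSum _ fun i _ => hterm i, finiteCondEntropy, ENNReal.ofReal_sum_of_nonneg]
  · refine Finset.sum_congr rfl fun i _ => ?_
    have hle := partitionSigma_le β
    rw [ofReal_integral_eq_lintegral_ofReal (integrable_negMulLog_condProb hle (hS n i))]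
    · refine lintegral_congr_ae ?_
      filter_upwards [D.toReal_meas_ae_eq_condProb (hS n i)] with x hx
      rw [← hx]
    · filter_upwards [condProb_nonneg (μ := μ) (m := partitionSigma β) (ξ n ⁻¹' {i}),
        condProb_le_one hle (hS n i)] with x h0 h1
      exact Real.negMulLog_nonneg h0 h1
  · intro i _
    refine integral_nonneg_of_ae ?_
    filter_upwards [condProb_nonneg (μ := μ) (m := partitionSigma β) (ξ n ⁻¹' {i}),
      condProb_le_one (partitionSigma_le β) (hS n i)] with x h0 h1
    exact Real.negMulLog_nonneg h0 h1

end CanonicalSystem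

/-! ### Separating families in Lebesgue spaces -/

section Separation

variable {X : Type*} [B : MeasurableSpace X] {μ : Measure X}

/-- The coding map of a family of measurable sets is measurable. -/
lemma measurable_decide_mem {Y ι : Type*} [MeasurableSpace Y] {R : ι → Set Y}
    [∀ i, DecidablePred (· ∈ R i)] (hR : ∀ i, MeasurableSet (R i)) :
    Measurable fun (y : Y) (i : ι) => decide (y ∈ R i) := by
  refine measurable_pi_iff.2 fun i => measurable_to_bool ?_
  have : (fun y => decide (y ∈ R i)) ⁻¹' {true} = R i := by ext; simp
  rw [this]
  exact hR i

/-- In a Lebesgue space, a measurable set which is separated from its complement by a countable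
family of measurable sets, up to a null set, belongs modulo null sets to the σ-algebra generated by
the family. The images of the set and of its complement in `{0, 1}^ι` are, after transport to the
line and removal of null sets, disjoint analytic sets, hence separated by a Borel set. -/
theorem IsLebesgueSpace.exists_ae_eq_of_separating (hX : IsLebesgueSpace μ) {ι : Type*}
    [Countable ι] {S : ι → Set X} (hS : ∀ i, MeasurableSet (S i)) {E : Set X}
    (hE : MeasurableSet E) {N : Set X} (hN : μ N = 0)
    (hsep : ∀ x ∈ E \ N, ∀ y ∈ Eᶜ \ N, ∃ i, ¬ (x ∈ S i ↔ y ∈ S i)) :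
    ∃ E', MeasurableSet[MeasurableSpace.generateFrom (Set.range S)] E' ∧ E =ᵐ[μ] E' := by
  classical
  obtain ⟨-, hcompl, ν, X₀, Y₀, f, hν, hX₀, hY₀, hf, hfm, hfμ⟩ := hX
  have hnull : ∀ S : Set X, μ S = 0 → MeasurableSet S := fun S h => measurableSet_of_null h
  have hX₀m : MeasurableSet X₀ := by simpa using (hnull _ hX₀).compl
  have himg : ∀ S, MeasurableSet S → NullMeasurableSet (f '' (S ∩ X₀)) ν := fun S hS =>
    (hfm _ Set.inter_subset_right).1 (hS.inter hX₀m)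
  have hNm := hnull N hN
  -- Borel sets inside the images of `E` and of its complement
  obtain ⟨P, hPsub, hPm, hP⟩ := (himg _ (hE.diff hNm)).exists_measurable_subset_ae_eq
  obtain ⟨Q, hQsub, hQm, hQ⟩ := (himg _ (hE.compl.diff hNm)).exists_measurable_subset_ae_eq
  -- a Borel version of the coding map, seen on the line
  choose R hRm hR using fun i => ((himg _ (hS i)).exists_measurable_superset_ae_eq).imp
    fun _ h => h.2
  set ψ : ℝ → ι → Bool := fun y i => decide (y ∈ R i) with hψ
  have hψm : Measurable ψ := measurable_decide_mem hRm
  set φ : X → ι → Bool := fun x i => decide (x ∈ S i) with hφ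
  have hφm : Measurable[MeasurableSpace.generateFrom (Set.range S)] φ := 
    @measurable_decide_mem _ _ (MeasurableSpace.generateFrom (Set.range S)) _ _ fun i =>
      MeasurableSpace.measurableSet_generateFrom ⟨i, rfl⟩
  -- off a Borel null set of the line the two coding maps agree
  have hbad : ∀ᵐ y ∂ν, ∀ i, (y ∈ R i ↔ y ∈ f '' (S i ∩ X₀)) :=
    ae_all_iff.2 fun i => (hR i).mem_iff
  obtain ⟨M, hMsub, hMm, hM⟩ := exists_measurable_superset_of_null hbad
  have hagree : ∀ x ∈ X₀, f x ∉ M → ψ (f x) = φ x := by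
    intro x hx hfx
    ext1 i
    have h1 : ∀ i, (f x ∈ R i ↔ f x ∈ f '' (S i ∩ X₀)) := by
      by_contra h
      exact hfx (hMsub h)
    have h2 : f x ∈ f '' (S i ∩ X₀) ↔ x ∈ S i := by
      constructor
      · rintro ⟨z, ⟨hzS, hz⟩, hzx⟩
        rwa [← hf.injOn hz hx hzx]
      · exact fun h => ⟨x, ⟨h, hx⟩, rfl⟩
    simp only [hψ, hφ, (h1 i).trans h2]
  have hdisj : Disjoint (ψ '' (P \ M)) (ψ '' (Q \ M)) := by
    rw [Set.disjoint_left]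
    rintro _ ⟨y, ⟨hyP, hyM⟩, rfl⟩ ⟨z, ⟨hzQ, hzM⟩, hzy⟩
    obtain ⟨x, ⟨hxE, hx⟩, rfl⟩ := hPsub hyP
    obtain ⟨w, ⟨hwE, hw⟩, rfl⟩ := hQsub hzQ
    rw [hagree x hx hyM, hagree w hw hzM] at hzy
    obtain ⟨i, hi⟩ := hsep x hxE w hwE
    have := congrFun hzy i
    simp only [hφ, decide_eq_decide] at this
    exact hi this.symm
  obtain ⟨T, hPT, hQT, hTm⟩ := ((hPm.diff hMm).analyticSet_image hψm).measurablySeparable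
    ((hQm.diff hMm).analyticSet_image hψm) hdisj
  refine ⟨φ ⁻¹' T, hφm hTm, ?_⟩
  -- the points at which the argument breaks down form a null set
  have hgood : ∀ᵐ y ∂ν, y ∉ M ∧ (y ∈ P ↔ y ∈ f '' (E \ N ∩ X₀)) ∧
      (y ∈ Q ↔ y ∈ f '' (Eᶜ \ N ∩ X₀)) := by
    filter_upwards [measure_eq_zero_iff_ae_notMem.1 hM, hP.mem_iff, hQ.mem_iff] with y h1 h2 h3
    exact ⟨h1, h2, h3⟩
  set Z : Set ℝ := {y | ¬ (y ∉ M ∧ (y ∈ P ↔ y ∈ f '' (E \ N ∩ X₀)) ∧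
      (y ∈ Q ↔ y ∈ f '' (Eᶜ \ N ∩ X₀)))} with hZ
  have hZ0 : ν Z = 0 := hgood
  have hpre : μ (X₀ ∩ f ⁻¹' Z) = 0 := by
    have h0 : ν (f '' (X₀ ∩ f ⁻¹' Z)) = 0 :=
      measure_mono_null (by rintro _ ⟨x, hx, rfl⟩; exact hx.2) hZ0
    rw [← hfμ _ Set.inter_subset_left
      ((hfm _ Set.inter_subset_left).2 (NullMeasurableSet.of_null h0)), h0]
  filter_upwards [measure_eq_zero_iff_ae_notMem.1 hX₀, measure_eq_zero_iff_ae_notMem.1 hpre,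
    measure_eq_zero_iff_ae_notMem.1 hN] with x hx hxZ hxN
  have hx0 : x ∈ X₀ := not_not.1 hx
  have hfx : f x ∉ M ∧ (f x ∈ P ↔ f x ∈ f '' (E \ N ∩ X₀)) ∧
      (f x ∈ Q ↔ f x ∈ f '' (Eᶜ \ N ∩ X₀)) := by
    by_contra h
    exact hxZ ⟨hx0, h⟩
  obtain ⟨hxM, hxP, hxQ⟩ := hfx
  refine propext (show x ∈ E ↔ φ x ∈ T from ⟨fun hxE => ?_, fun hxT => ?_⟩)
  · rw [← hagree x hx0 hxM]
    exact hPT ⟨f x, ⟨hxP.2 ⟨x, ⟨⟨hxE, hxN⟩, hx0⟩, rfl⟩, hxM⟩, rfl⟩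
  · by_contra hxE
    rw [← hagree x hx0 hxM] at hxT
    exact Set.disjoint_left.1 hQT ⟨f x, ⟨hxQ.2 ⟨x, ⟨⟨hxE, hxN⟩, hx0⟩, rfl⟩, hxM⟩, rfl⟩ hxT

end Separation

/-! ### Shearer's inequality and convergence along invariant sets -/

section OrnsteinWeiss

open scoped Pointwise
open Classical in
/-- Shearer's inequality: if `f` is monotone and submodular, and the sets `E i` cover every point
of `F` at least `k` times, then `k f(F) ≤ ∑ f(E i ∩ F)`. -/
theorem card_mul_le_sum_of_submodular {G ι : Type*} {f : Finset G → ℝ} (h0 : f ∅ = 0)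
    (hmono : Monotone f)
    (hsub : ∀ E F x, E ⊆ F → f (insert x F) - f F ≤ f (insert x E) - f E)
    (s : Finset ι) (E : ι → Finset G) (k : ℕ) (F : Finset G)
    (hk : ∀ x ∈ F, k ≤ (s.filter fun i => x ∈ E i).card) :
    k * f F ≤ ∑ i ∈ s, f (E i ∩ F) := by
  induction F using Finset.induction_on with
  | empty => simp [h0]
  | insert x F hx ih =>
    have ih := ih fun y hy => hk y (Finset.mem_insert_of_mem hy)
    have hinc : 0 ≤ f (insert x F) - f F := sub_nonneg.2 (hmono (Finset.subset_insert x F))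
    have h1 : (k : ℝ) * (f (insert x F) - f F) ≤
        ∑ i ∈ s.filter fun i => x ∈ E i, (f (insert x F) - f F) := by
      rw [Finset.sum_const, nsmul_eq_mul]
      exact mul_le_mul_of_nonneg_right
        (by exact_mod_cast hk x (Finset.mem_insert_self x F)) hinc
    have h2 : ∑ i ∈ s.filter fun i => x ∈ E i, (f (insert x F) - f F) ≤
        ∑ i ∈ s, (f (E i ∩ insert x F) - f (E i ∩ F)) := by
      rw [Finset.sum_filter]
      refine Finset.sum_le_sum fun i _ => ?_
      split_ifs with hi
      · rw [Finset.inter_insert_of_mem hi]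
        exact hsub _ _ _ Finset.inter_subset_right
      · exact sub_nonneg.2
          (hmono (Finset.inter_subset_inter_left (Finset.subset_insert x F)))
    have h3 := h1.trans h2
    rw [Finset.sum_sub_distrib, mul_sub] at h3
    linarith

variable {G : Type*} [Group G]

open Classical in
/-- The right translates `K c` with `c ∈ K⁻¹ F` cover every point of `F` exactly `|K|` times;
hence Shearer's inequality compares the averages of `f` over `F` and `K`. -/
theorem card_mul_le_card_inv_mul_mul {f : Finset G → ℝ} (h0 : f ∅ = 0) (hmono : Monotone f)
    (hsub : ∀ E F x, E ⊆ F → f (insert x F) - f F ≤ f (insert x E) - f E)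
    (hinv : ∀ F c, f (F.image (· * c)) = f F) (K F : Finset G) :
    K.card * f F ≤ (K⁻¹ * F).card * f K := by
  refine (card_mul_le_sum_of_submodular h0 hmono hsub (K⁻¹ * F) (fun c => K.image (· * c)) K.card
    F fun x hx => ?_).trans ?_
  · refine Finset.card_le_card_of_injOn (fun k => k⁻¹ * x) (fun k hk => ?_) ?_
    · rw [Finset.mem_coe, Finset.mem_filter]
      exact ⟨Finset.mul_mem_mul (Finset.inv_mem_inv hk) hx,
        Finset.mem_image.2 ⟨k, hk, mul_inv_cancel_left k x⟩⟩
    · intro a _ b _ hab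
      exact inv_injective (mul_right_cancel hab)
  · rw [← nsmul_eq_mul, ← Finset.sum_const]
    refine Finset.sum_le_sum fun c _ => ?_
    rw [← hinv K c]
    exact hmono Finset.inter_subset_left

open Classical in
lemma card_inv_mul_le {K F : Finset G} {δ : ℝ} (hF : F.Nonempty)
    (h : ∀ g ∈ K⁻¹, invarianceDefect g F ≤ δ) :
    ((K⁻¹ * F).card : ℝ) ≤ (1 + K.card * δ) * F.card := by
  have hFpos : (0 : ℝ) < F.card := by exact_mod_cast hF.card_pos
  have hsub : K⁻¹ * F ⊆ F ∪ K⁻¹.biUnion fun g => F.image (g * ·) \ F := by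
    intro x hx
    obtain ⟨g, hg, y, hy, rfl⟩ := Finset.mem_mul.1 hx
    by_cases hgy : g * y ∈ F
    · exact Finset.mem_union_left _ hgy
    · exact Finset.mem_union_right _ (Finset.mem_biUnion.2
        ⟨g, hg, Finset.mem_sdiff.2 ⟨Finset.mem_image_of_mem _ hy, hgy⟩⟩)
  have h1 : ∀ g ∈ K⁻¹, ((F.image (g * ·) \ F).card : ℝ) ≤ δ * F.card := by
    intro g hg
    have h2 := (div_le_iff₀ hFpos).1 (h g hg)
    refine le_trans ?_ h2
    rw [← Set.ncard_coe_finset]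
    have hfin : (symmDiff ((fun x => g * x) '' (F : Set G)) (F : Set G)).Finite :=
      ((F.finite_toSet.image _).union F.finite_toSet).subset Set.symmDiff_subset_union
    refine Nat.cast_le.2 (Set.ncard_le_ncard ?_ hfin)
    intro x hx
    rw [Finset.coe_sdiff, Finset.coe_image] at hx
    exact Or.inl hx
  calc ((K⁻¹ * F).card : ℝ) ≤ (F.card + ∑ g ∈ K⁻¹, (F.image (g * ·) \ F).card : ℕ) := by
        refine Nat.cast_le.2 ((Finset.card_le_card hsub).trans
          ((Finset.card_union_le _ _).trans ?_))
        exact Nat.add_le_add_left Finset.card_biUnion_le _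
    _ ≤ F.card + ∑ g ∈ K⁻¹, δ * F.card := by
        push_cast
        gcongr with g hg
        exact h1 g hg
    _ = (1 + K.card * δ) * F.card := by
        rw [Finset.sum_const, Finset.card_inv, nsmul_eq_mul]
        ring

lemma eventually_moreAndMoreInvariant (K : Finset G) {δ : ℝ} (hδ : 0 < δ) :
    ∀ᶠ F in moreAndMoreInvariant G, F.Nonempty ∧ ∀ g ∈ K, invarianceDefect g F ≤ δ :=
  mem_iInf_of_mem K (mem_iInf_of_mem δ (mem_iInf_of_mem hδ (mem_principal_self _)))

lemma moreAndMoreInvariant_neBot (hG : IsAmenableGroup G) : (moreAndMoreInvariant G).NeBot := by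
  obtain ⟨F, hF, hlim⟩ := hG
  have h : Tendsto F atTop (moreAndMoreInvariant G) := by
    simp only [moreAndMoreInvariant, tendsto_iInf, tendsto_principal]
    intro K δ hδ
    have : ∀ᶠ n in atTop, ∀ g ∈ K, invarianceDefect g (F n) < δ :=
      (Filter.eventually_all_finset K).2 fun g _ => (hlim g).eventually_lt_const hδ
    filter_upwards [this] with n hn
    exact ⟨hF n, fun g hg => (hn g hg).le⟩
  exact h.neBot

open Classical in
/-- The averages of a function which satisfies the covering inequality of
`card_mul_le_card_inv_mul_mul` converge to their infimum along more and more invariant sets. -/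
theorem tendsto_div_card_moreAndMoreInvariant {f : Finset G → ℝ≥0∞}
    (hf : ∀ K F : Finset G, (K.card : ℝ≥0∞) * f F ≤ ((K⁻¹ * F).card : ℝ≥0∞) * f K) :
    Tendsto (fun F => f F / (F.card : ℝ≥0∞)) (moreAndMoreInvariant G)
      (𝓝 (⨅ (K : Finset G) (_ : K.Nonempty), f K / (K.card : ℝ≥0∞))) := by
  refine tendsto_order.2 ⟨fun a ha => ?_, fun a ha => ?_⟩
  · filter_upwards [eventually_moreAndMoreInvariant (∅ : Finset G) one_pos] with F hF
    exact ha.trans_le (iInf₂_le F hF.1)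
  · obtain ⟨K, hK⟩ := iInf_lt_iff.1 ha
    obtain ⟨hKne, hKa⟩ := iInf_lt_iff.1 hK
    have hlim : Tendsto (fun δ : ℝ => ENNReal.ofReal (1 + K.card * δ) * (f K / K.card)) (𝓝[>] 0)
        (𝓝 (ENNReal.ofReal (1 + K.card * 0) * (f K / K.card))) := by
      refine ENNReal.Tendsto.mul_const (ENNReal.tendsto_ofReal ?_) (Or.inl (by simp))
      exact ((continuous_const.add (continuous_const.mul continuous_id)).tendsto 0).mono_left
        nhdsWithin_le_nhds
    have hlt : ENNReal.ofReal (1 + K.card * 0) * (f K / K.card) < a := by simpa using hKa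
    obtain ⟨δ, hδa, hδ⟩ := ((hlim.eventually_lt_const hlt).and self_mem_nhdsWithin).exists
    filter_upwards [eventually_moreAndMoreInvariant K⁻¹ hδ] with F ⟨hF, hdef⟩
    refine lt_of_le_of_lt ?_ hδa
    have hFpos : (F.card : ℝ≥0∞) ≠ 0 := by exact_mod_cast hF.card_pos.ne'
    have hKpos : (K.card : ℝ≥0∞) ≠ 0 := by exact_mod_cast hKne.card_pos.ne'
    have hcard : ((K⁻¹ * F).card : ℝ≥0∞) ≤ ENNReal.ofReal (1 + K.card * δ) * F.card := by
      rw [← ENNReal.ofReal_natCast, ← ENNReal.ofReal_natCast F.card,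
        ← ENNReal.ofReal_mul' (by positivity)]
      exact ENNReal.ofReal_le_ofReal (card_inv_mul_le hF hdef)
    refine ENNReal.div_le_of_le_mul ?_
    calc f F = (K.card : ℝ≥0∞) * f F / K.card := by
          rw [mul_comm, ENNReal.mul_div_cancel_right hKpos (by simp)]
      _ ≤ ENNReal.ofReal (1 + K.card * δ) * F.card * f K / K.card :=
          ENNReal.div_le_div_right ((hf K F).trans (mul_le_mul_left hcard _)) _
      _ = ENNReal.ofReal (1 + K.card * δ) * (f K / K.card) * F.card := by
          simp only [div_eq_mul_inv]
          ring

end OrnsteinWeiss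

/-! ### Entropy of orbit partitions -/

section OrbitEntropy

open scoped Pointwise

/-- A finite-valued map which refines another one generates the larger σ-algebra. -/
lemma comap_le_comap_of_refines {Ω ι κ : Type*} [MeasurableSpace ι] [MeasurableSpace κ] [Finite κ]
    [MeasurableSingletonClass κ] {ξ : Ω → ι} {η : Ω → κ} (h : ∀ x y, η x = η y → ξ x = ξ y) :
    MeasurableSpace.comap ξ inferInstance ≤ MeasurableSpace.comap η inferInstance := by
  rintro _ ⟨T, -, rfl⟩
  refine ⟨η '' (ξ ⁻¹' T), (Set.toFinite _).measurableSet, ?_⟩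
  refine Set.Subset.antisymm ?_ (Set.subset_preimage_image _ _)
  rintro x ⟨y, hy, hyx⟩
  rwa [Set.mem_preimage, ← h y x hyx]

variable {G X : Type*} [Group G] [MulAction G X]

/-- The values of `ξ` along the partial orbit `F x`; its level sets form the partition `ξ^F`. -/
def orbitMap {ι : Type*} (ξ : X → ι) (F : Finset G) (x : X) : F → ι := fun g => ξ (g.1 • x)

lemma orbitMap_eq_iff {ι : Type*} {ξ : X → ι} {F : Finset G} {x y : X} :
    orbitMap ξ F x = orbitMap ξ F y ↔ ∀ g ∈ F, ξ (g • x) = ξ (g • y) := by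
  simp [orbitMap, funext_iff]

lemma measurable_orbitMap {ι : Type*} [MeasurableSpace ι] [MeasurableSpace X] {μ : Measure X}
    (hT : ∀ g : G, MeasurePreserving (fun x : X => g • x) μ μ) {ξ : X → ι} (hξ : Measurable ξ)
    (F : Finset G) : Measurable (orbitMap ξ F) :=
  measurable_pi_iff.2 fun g => hξ.comp (hT g.1).measurable

variable {A : MeasurableSpace X} [B : MeasurableSpace X]
  {μ : Measure X} [IsProbabilityMeasure μ]
variable {ι κ : Type*} [Fintype ι] [Fintype κ] [MeasurableSpace ι] [MeasurableSpace κ]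
  [MeasurableSingletonClass ι] [MeasurableSingletonClass κ]

lemma finiteCondEntropy_comp_smul (hA : A ≤ B)
    (hT : ∀ g : G, MeasurePreserving (fun x : X => g • x) μ μ)
    (hGA : ∀ g : G, A.comap (fun x : X => g • x) = A) {ξ : X → ι} (hξ : Measurable ξ) (g : G) :
    finiteCondEntropy μ A (fun x => ξ (g • x)) = finiteCondEntropy μ A ξ := by
  have := finiteCondEntropy_comap hA (hT g) hξ
  rwa [hGA g] at this

open Classical in
/-- The increment of the orbit entropy, from the chain rule. -/
lemma finiteCondEntropy_orbitMap_insert (hA : A ≤ B)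
    (hT : ∀ g : G, MeasurePreserving (fun x : X => g • x) μ μ) {ξ : X → ι} (hξ : Measurable ξ)
    (g : G) (F : Finset G) :
    finiteCondEntropy μ A (orbitMap ξ (insert g F)) = finiteCondEntropy μ A (orbitMap ξ F) +
      finiteCondEntropy μ (A ⊔ MeasurableSpace.comap (orbitMap ξ F) inferInstance)
        (fun x => ξ (g • x)) := by
  have hg : Measurable fun x => ξ (g • x) := hξ.comp (hT g).measurable
  have hF := measurable_orbitMap hT hξ F
  rw [← finiteCondEntropy_prod hA hg hF]
  refine finiteCondEntropy_congr_level hA (measurable_orbitMap hT hξ _) (hg.prodMk hF) ?_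
  intro x y
  simp [orbitMap_eq_iff]

open Classical in
lemma finiteCondEntropy_orbitMap_empty {ι : Type*} [Fintype ι] (hA : A ≤ B) (ξ : X → ι) :
    finiteCondEntropy μ A (orbitMap ξ (∅ : Finset G)) = 0 := by
  refine finiteCondEntropy_eq_zero hA fun i => ⟨Set.univ, MeasurableSet.univ, ?_⟩
  have : orbitMap ξ (∅ : Finset G) ⁻¹' {i} = Set.univ :=
    Set.eq_univ_of_forall fun x => Subsingleton.elim _ _
  rw [this]
  exact ae_eq_refl _

open Classical in
lemma finiteCondEntropy_orbitMap_mono (hA : A ≤ B)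
    (hT : ∀ g : G, MeasurePreserving (fun x : X => g • x) μ μ) {ξ : X → ι} (hξ : Measurable ξ) :
    Monotone fun F : Finset G => finiteCondEntropy μ A (orbitMap ξ F) := by
  intro E F hEF
  refine finiteCondEntropy_mono hA (measurable_orbitMap hT hξ E) (measurable_orbitMap hT hξ F) ?_
  intro x y h
  exact orbitMap_eq_iff.2 fun g hg => orbitMap_eq_iff.1 h g (hEF hg)

open Classical in
/-- The covering inequality for the entropies of `ξ^F` given an invariant σ-algebra. -/
theorem card_mul_finiteCondEntropy_orbitMap_le (hA : A ≤ B)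
    (hT : ∀ g : G, MeasurePreserving (fun x : X => g • x) μ μ)
    (hGA : ∀ g : G, A.comap (fun x : X => g • x) = A) {ξ : X → ι} (hξ : Measurable ξ)
    (K F : Finset G) :
    K.card * finiteCondEntropy μ A (orbitMap ξ F) ≤
      (K⁻¹ * F).card * finiteCondEntropy μ A (orbitMap ξ K) := by
  have hle : ∀ F : Finset G, A ⊔ MeasurableSpace.comap (orbitMap ξ F) inferInstance ≤ B :=
    fun F => sup_le hA (measurable_orbitMap hT hξ F).comap_le
  refine card_mul_le_card_inv_mul_mul (f := fun F => finiteCondEntropy μ A (orbitMap ξ F))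
    (finiteCondEntropy_orbitMap_empty hA ξ) (finiteCondEntropy_orbitMap_mono hA hT hξ) ?_ ?_ K F
  · intro E F g hEF
    rw [finiteCondEntropy_orbitMap_insert hA hT hξ, finiteCondEntropy_orbitMap_insert hA hT hξ,
      add_sub_cancel_left, add_sub_cancel_left]
    refine finiteCondEntropy_anti (hle E) (hle F) (AELe.of_le (sup_le_sup_left ?_ A))
      (hξ.comp (hT g).measurable)
    refine comap_le_comap_of_refines fun x y h => ?_
    exact orbitMap_eq_iff.2 fun g hg => orbitMap_eq_iff.1 h g (hEF hg)
  · intro F c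
    rw [← finiteCondEntropy_comp_smul hA hT hGA (measurable_orbitMap hT hξ F) c]
    refine finiteCondEntropy_congr_level hA (measurable_orbitMap hT hξ _)
      ((measurable_orbitMap hT hξ F).comp (hT c).measurable) fun x y => ?_
    change orbitMap ξ F (c • x) = orbitMap ξ F (c • y) ↔ _
    simp only [orbitMap_eq_iff, Finset.forall_mem_image, mul_smul]

open Classical in
/-- `H(ξ^F | A) ≤ ∑_{g ∈ F} H(g⁻¹ ξ | A)`. -/
lemma finiteCondEntropy_orbitMap_le_sum (hA : A ≤ B)
    (hT : ∀ g : G, MeasurePreserving (fun x : X => g • x) μ μ) {ξ : X → ι} (hξ : Measurable ξ)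
    (F : Finset G) :
    finiteCondEntropy μ A (orbitMap ξ F) ≤
      ∑ g ∈ F, finiteCondEntropy μ A (fun x => ξ (g • x)) := by
  induction F using Finset.induction_on with
  | empty => simp [finiteCondEntropy_orbitMap_empty hA ξ]
  | insert g F hg ih =>
    rw [finiteCondEntropy_orbitMap_insert hA hT hξ, Finset.sum_insert hg, add_comm]
    refine add_le_add ?_ ih
    exact finiteCondEntropy_anti hA (sup_le hA (measurable_orbitMap hT hξ F).comap_le)
      (AELe.of_le le_sup_left) (hξ.comp (hT g).measurable)

open Classical in
/-- `H(ξ^F | A) ≤ H(η^F | A) + |F| H(ξ | A ⊔ σ(η))` for an invariant σ-algebra `A`. -/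
theorem finiteCondEntropy_orbitMap_le_add (hA : A ≤ B)
    (hT : ∀ g : G, MeasurePreserving (fun x : X => g • x) μ μ)
    (hGA : ∀ g : G, A.comap (fun x : X => g • x) = A) {ξ : X → ι} (hξ : Measurable ξ)
    {η : X → κ} (hη : Measurable η) (F : Finset G) :
    finiteCondEntropy μ A (orbitMap ξ F) ≤ finiteCondEntropy μ A (orbitMap η F) +
      F.card * finiteCondEntropy μ (A ⊔ MeasurableSpace.comap η inferInstance) ξ := by
  have hξF := measurable_orbitMap hT hξ F
  have hηF := measurable_orbitMap hT hη F
  refine (finiteCondEntropy_mono hA hξF (hξF.prodMk hηF)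
    fun x y h => (Prod.ext_iff.1 h).1).trans ?_
  rw [finiteCondEntropy_prod hA hξF hηF]
  refine add_le_add_right ?_ _
  have hm := sup_le hA hηF.comap_le
  refine (finiteCondEntropy_orbitMap_le_sum hm hT hξ F).trans ?_
  rw [← nsmul_eq_mul, ← Finset.sum_const]
  refine Finset.sum_le_sum fun g hg => ?_
  have hm' : A ⊔ MeasurableSpace.comap η inferInstance ≤ B := sup_le hA hη.comap_le
  have h1 := finiteCondEntropy_comap hm' (hT g) hξ
  rw [MeasurableSpace.comap_sup, hGA g, MeasurableSpace.comap_comp] at h1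
  rw [← h1]
  refine finiteCondEntropy_anti (sup_le hA (hη.comp (hT g).measurable).comap_le) hm
    (AELe.of_le (sup_le_sup_left ?_ A)) (hξ.comp (hT g).measurable)
  exact comap_le_comap_of_refines fun x y h => orbitMap_eq_iff.1 h g hg

open Classical in
/-- `H((ξ ∨ η)^F | A) ≤ H(ξ^F | A) + H(η^F | A)`. -/
theorem finiteCondEntropy_orbitMap_prod_le (hA : A ≤ B)
    (hT : ∀ g : G, MeasurePreserving (fun x : X => g • x) μ μ) {ξ : X → ι} (hξ : Measurable ξ)
    {η : X → κ} (hη : Measurable η) (F : Finset G) :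
    finiteCondEntropy μ A (orbitMap (fun x => (ξ x, η x)) F) ≤
      finiteCondEntropy μ A (orbitMap ξ F) + finiteCondEntropy μ A (orbitMap η F) := by
  have hξF := measurable_orbitMap hT hξ F
  have hηF := measurable_orbitMap hT hη F
  have h : finiteCondEntropy μ A (orbitMap (fun x => (ξ x, η x)) F) ≤
      finiteCondEntropy μ A (fun x => (orbitMap ξ F x, orbitMap η F x)) := by
    refine finiteCondEntropy_mono hA (measurable_orbitMap hT (hξ.prodMk hη) F) (hξF.prodMk hηF) ?_
    intro x y h
    obtain ⟨h1, h2⟩ := Prod.ext_iff.1 h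
    exact orbitMap_eq_iff.2 fun g hg =>
      Prod.ext (orbitMap_eq_iff.1 h1 g hg) (orbitMap_eq_iff.1 h2 g hg)
  refine h.trans ?_
  rw [finiteCondEntropy_prod hA hξF hηF, add_comm]
  refine add_le_add_left ?_ _
  exact finiteCondEntropy_anti hA (sup_le hA hηF.comap_le) (AELe.of_le le_sup_left) hξF

end OrbitEntropy

/-! ### Exhaustion of measurable partitions -/

section Exhaustion

variable {X : Type*} {ι κ : ℕ → Type*}

/-- The finite partitions into the level sets of `ξ 0, ξ 1, …` are measurable, increase, and their
join is the partition `γ`. -/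
structure Exhausts [MeasurableSpace X] [∀ n, MeasurableSpace (ι n)] (ξ : ∀ n, X → ι n)
    (γ : Setoid X) : Prop where
  measurable : ∀ n, Measurable (ξ n)
  refines : ∀ n x y, ξ (n + 1) x = ξ (n + 1) y → ξ n x = ξ n y
  rel_iff : ∀ x y, γ x y ↔ ∀ n, ξ n x = ξ n y

open Classical in
/-- The map which records membership in the first `n` sets of a sequence. -/
def firstCode (S : ℕ → Set X) (n : ℕ) (x : X) : Fin n → Bool := fun i => decide (x ∈ S i)

lemma firstCode_eq_iff {S : ℕ → Set X} {n : ℕ} {x y : X} :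
    firstCode S n x = firstCode S n y ↔ ∀ i < n, (x ∈ S i ↔ y ∈ S i) := by
  simp only [firstCode, funext_iff, decide_eq_decide]
  exact ⟨fun h i hi => h ⟨i, hi⟩, fun h i => h i i.2⟩

open Classical in
lemma measurable_firstCode [MeasurableSpace X] {S : ℕ → Set X} (hS : ∀ n, MeasurableSet (S n))
    (n : ℕ) : Measurable (firstCode S n) :=
  measurable_decide_mem fun i : Fin n => hS i

lemma exhausts_firstCode [MeasurableSpace X] {S : ℕ → Set X} {γ : Setoid X}
    (hS : ∀ n, MeasurableSet (S n)) (hγ : ∀ n, IsPartitionSet γ (S n))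
    (hsep : ∀ x y, ¬ γ x y → ∃ n, ¬ (x ∈ S n ↔ y ∈ S n)) : Exhausts (firstCode S) γ where
  measurable := measurable_firstCode hS
  refines n x y h := firstCode_eq_iff.2 fun i hi =>
    firstCode_eq_iff.1 h i (hi.trans n.lt_succ_self)
  rel_iff x y := by
    refine ⟨fun h n => firstCode_eq_iff.2 fun i _ =>
      ⟨hγ i x y h, hγ i y x (γ.symm h)⟩, fun h => ?_⟩
    by_contra hxy
    obtain ⟨n, hn⟩ := hsep x y hxy
    exact hn (firstCode_eq_iff.1 (h (n + 1)) n n.lt_succ_self)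

lemma measurableSet_comap_firstCode (S : ℕ → Set X) (n : ℕ) :
    MeasurableSet[MeasurableSpace.comap (firstCode S (n + 1)) inferInstance] (S n) := by
  refine ⟨{c | c (Fin.last n) = true}, (Set.toFinite _).measurableSet, ?_⟩
  ext x
  simp [firstCode]

variable [B : MeasurableSpace X] [∀ n, MeasurableSpace (ι n)] [∀ n, MeasurableSpace (κ n)]
  {ξ : ∀ n, X → ι n} {η : ∀ n, X → κ n} {α β : Setoid X}

lemma Exhausts.join (hξ : Exhausts ξ α) (hη : Exhausts η β) :
    Exhausts (fun n x => (ξ n x, η n x)) (partitionJoin α β) where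
  measurable n := (hξ.measurable n).prodMk (hη.measurable n)
  refines n x y h := by
    obtain ⟨h1, h2⟩ := Prod.ext_iff.1 h
    exact Prod.ext (hξ.refines n x y h1) (hη.refines n x y h2)
  rel_iff x y := by
    change α x y ∧ β x y ↔ _
    simp only [hξ.rel_iff, hη.rel_iff, Prod.ext_iff, forall_and]

lemma partitionOrbit_iff {X G : Type*} {α : Setoid X} [Group G] [MulAction G X] {F : Finset G}
    {x y : X} :
    partitionOrbit α F x y ↔ ∀ g ∈ F, α (g • x) (g • y) := by
  unfold partitionOrbit
  rw [iInf, Setoid.sInf_iff, Set.forall_mem_range]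
  refine forall_congr' fun g => ?_
  rw [iInf, Setoid.sInf_iff, Set.forall_mem_range]
  rfl

lemma Exhausts.orbit {G : Type*} [Group G] [MulAction G X] {μ : Measure X} (hξ : Exhausts ξ α)
    (hT : ∀ g : G, MeasurePreserving (fun x : X => g • x) μ μ) (F : Finset G) :
    Exhausts (fun n => orbitMap (ξ n) F) (partitionOrbit α F) where
  measurable n := measurable_orbitMap hT (hξ.measurable n) F
  refines n x y h := orbitMap_eq_iff.2 fun g hg =>
    hξ.refines n _ _ (orbitMap_eq_iff.1 h g hg)
  rel_iff x y := by
    simp only [partitionOrbit_iff, hξ.rel_iff, orbitMap_eq_iff]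
    exact ⟨fun h n g hg => h g hg n, fun h g hg n => h n g hg⟩

lemma IsMeasurablePartition.join (hα : IsMeasurablePartition α) (hβ : IsMeasurablePartition β) :
    IsMeasurablePartition (partitionJoin α β) := by
  obtain ⟨S, hS, hSα, hSsep⟩ := hα
  obtain ⟨T, hT, hTβ, hTsep⟩ := hβ
  refine ⟨fun n => Sum.elim S T (Equiv.natSumNatEquivNat.symm n), fun n => ?_, fun n => ?_, ?_⟩
  · beta_reduce
    rcases Equiv.natSumNatEquivNat.symm n with k | k
    exacts [hS k, hT k]
  · beta_reduce
    rcases Equiv.natSumNatEquivNat.symm n with k | k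
    exacts [fun x y h => hSα k x y h.1, fun x y h => hTβ k x y h.2]
  · intro x y h
    have h' : ¬ (α x y ∧ β x y) := h
    rcases not_and_or.1 h' with h1 | h1
    · obtain ⟨k, hk⟩ := hSsep x y h1
      exact ⟨Equiv.natSumNatEquivNat (Sum.inl k), by simpa using hk⟩
    · obtain ⟨k, hk⟩ := hTsep x y h1
      exact ⟨Equiv.natSumNatEquivNat (Sum.inr k), by simpa using hk⟩

end Exhaustion

/-! ### Entropy of the orbits of a measurable partition -/

section OrbitEntropySup

open scoped Pointwise

variable {G X : Type*} [Group G] [MulAction G X] {A : MeasurableSpace X} [B : MeasurableSpace X]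
  {μ : Measure X} [IsProbabilityMeasure μ]
variable {ι κ : ℕ → Type*} [∀ n, Fintype (ι n)] [∀ n, Fintype (κ n)]
  [∀ n, MeasurableSpace (ι n)] [∀ n, MeasurableSpace (κ n)]
  [∀ n, MeasurableSingletonClass (ι n)] [∀ n, MeasurableSingletonClass (κ n)]
  {ξ : ∀ n, X → ι n} {η : ∀ n, X → κ n} {α β C : Setoid X}

/-- An increasing sequence of finite-valued maps generates a filtration together with `A`. -/
def Exhausts.filtration (hη : Exhausts η β) (hA : A ≤ B) : Filtration ℕ B where
  seq n := A ⊔ MeasurableSpace.comap (η n) inferInstance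
  mono' := monotone_nat_of_le_succ fun n =>
    sup_le_sup_left (comap_le_comap_of_refines (hη.refines n)) A
  le' n := sup_le hA (hη.measurable n).comap_le

open Classical in
/-- The entropy `H(γ^F | A)`, for a partition `γ` exhausted by the finite-valued maps `ξ n`. It is
defined as a supremum over `n`; `condEntropy_partitionOrbit` identifies it with `H(γ^F | C)`. -/
def orbitEntropy (μ : Measure X)
    (A : MeasurableSpace X) (ξ : ∀ n, X → ι n) (F : Finset G) : ℝ≥0∞ :=
  ⨆ n, ENNReal.ofReal (finiteCondEntropy μ A (orbitMap (ξ n) F))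

open Classical in
lemma condEntropy_partitionOrbit (hA : A ≤ B)
    (hT : ∀ g : G, MeasurePreserving (fun x : X => g • x) μ μ)
    (hC : Nonempty (CanonicalSystem μ C)) (hCA : AELe μ (partitionSigma C) A)
    (hAC : AELe μ A (partitionSigma C)) (hξ : Exhausts ξ α) (F : Finset G) :
    condEntropy μ (partitionOrbit α F) C = orbitEntropy μ A ξ F := by
  have h := hξ.orbit hT F
  rw [condEntropy_eq_iSup hC h.measurable h.refines h.rel_iff]
  exact iSup_congr fun n => congrArg _
    (finiteCondEntropy_congr_aeLe (partitionSigma_le C) hA hCA hAC (h.measurable n))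

open Classical in
lemma card_mul_orbitEntropy_le (hA : A ≤ B)
    (hT : ∀ g : G, MeasurePreserving (fun x : X => g • x) μ μ)
    (hGA : ∀ g : G, A.comap (fun x : X => g • x) = A) (hξ : Exhausts ξ α) (K F : Finset G) :
    (K.card : ℝ≥0∞) * orbitEntropy μ A ξ F ≤
      ((K⁻¹ * F).card : ℝ≥0∞) * orbitEntropy μ A ξ K := by
  rw [orbitEntropy, ENNReal.mul_iSup]
  refine iSup_le fun n => ?_
  refine le_trans ?_ (mul_le_mul_right (le_iSup (fun n => ENNReal.ofReal
    (finiteCondEntropy μ A (orbitMap (ξ n) K))) n) _)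
  rw [← ENNReal.ofReal_natCast, ← ENNReal.ofReal_natCast (K⁻¹ * F).card,
    ← ENNReal.ofReal_mul (Nat.cast_nonneg _), ← ENNReal.ofReal_mul (Nat.cast_nonneg _)]
  exact ENNReal.ofReal_le_ofReal
    (card_mul_finiteCondEntropy_orbitMap_le hA hT hGA (hξ.measurable n) K F)

open Classical in
lemma orbitEntropy_prod_le (hA : A ≤ B)
    (hT : ∀ g : G, MeasurePreserving (fun x : X => g • x) μ μ) (hξ : Exhausts ξ α)
    (hη : Exhausts η β) (F : Finset G) :
    orbitEntropy μ A (fun n x => (ξ n x, η n x)) F ≤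
      orbitEntropy μ A ξ F + orbitEntropy μ A η F := by
  refine iSup_le fun n => ?_
  refine (ENNReal.ofReal_le_ofReal (finiteCondEntropy_orbitMap_prod_le hA hT
    (hξ.measurable n) (hη.measurable n) F)).trans (ENNReal.ofReal_add_le.trans ?_)
  exact add_le_add (le_iSup (fun n => ENNReal.ofReal
    (finiteCondEntropy μ A (orbitMap (ξ n) F))) n) (le_iSup (fun n => ENNReal.ofReal
    (finiteCondEntropy μ A (orbitMap (η n) F))) n)

open Classical in
/-- `H(α^F | A) ≤ H(β^F | A) + |F| e` if `e` bounds the entropies, given `A` and `β`, of the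
finite partitions which exhaust `α`. -/
lemma orbitEntropy_le_add (hA : A ≤ B)
    (hT : ∀ g : G, MeasurePreserving (fun x : X => g • x) μ μ)
    (hGA : ∀ g : G, A.comap (fun x : X => g • x) = A) (hξ : Exhausts ξ α)
    (hη : Exhausts η β) {e : ℝ≥0∞}
    (he : ∀ n, ENNReal.ofReal (finiteCondEntropy μ
      (⨆ k, A ⊔ MeasurableSpace.comap (η k) inferInstance) (ξ n)) ≤ e) (F : Finset G) :
    orbitEntropy μ A ξ F ≤ orbitEntropy μ A η F + F.card * e := by
  refine iSup_le fun n => ?_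
  have hlim := tendsto_finiteCondEntropy (μ := μ) (hη.filtration hA) (hξ.measurable n)
  have hlim' : Tendsto (fun k => orbitEntropy μ A η F + F.card *
      ENNReal.ofReal (finiteCondEntropy μ (hη.filtration hA k) (ξ n))) atTop
      (𝓝 (orbitEntropy μ A η F + F.card *
        ENNReal.ofReal (finiteCondEntropy μ (⨆ k, hη.filtration hA k) (ξ n)))) :=
    tendsto_const_nhds.add (ENNReal.Tendsto.const_mul (ENNReal.tendsto_ofReal hlim)
      (Or.inr (ENNReal.natCast_ne_top _)))
  refine (ge_of_tendsto' hlim' fun k => ?_).trans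
    (add_le_add_right (mul_le_mul_right (he n) _) _)
  refine (ENNReal.ofReal_le_ofReal (finiteCondEntropy_orbitMap_le_add hA hT hGA
    (hξ.measurable n) (hη.measurable k) F)).trans (ENNReal.ofReal_add_le.trans ?_)
  rw [ENNReal.ofReal_mul (Nat.cast_nonneg _), ENNReal.ofReal_natCast]
  exact add_le_add_left (le_iSup (fun n => ENNReal.ofReal
    (finiteCondEntropy μ A (orbitMap (η n) F))) k) _

end OrbitEntropySup

/-! ### Comparison of σ-algebras modulo null sets -/

section SigmaAlgebras

variable {X : Type*} {A : MeasurableSpace X} [B : MeasurableSpace X] {μ : Measure X}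
  {β C : Setoid X}

lemma AELe.generateFrom {m : MeasurableSpace X} {𝒮 : Set (Set X)}
    (h : ∀ S ∈ 𝒮, ∃ S', MeasurableSet[m] S' ∧ S =ᵐ[μ] S') :
    AELe μ (MeasurableSpace.generateFrom 𝒮) m := by
  have hle : MeasurableSpace.generateFrom 𝒮 ≤ eventuallyMeasurableSpace m (ae μ) :=
    MeasurableSpace.generateFrom_le h
  exact hle

lemma IsPartitionOfSigmaAlgebra.partitionSigma_aeLe (hC : IsPartitionOfSigmaAlgebra A μ C) :
    AELe μ (partitionSigma C) A := fun S hS =>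
  (hC.2 S (partitionSigma_le C S hS)).1
    ⟨S, partitionSigma_le C S hS, (measurableSet_partitionSigma_iff.1 hS).2, ae_eq_refl _⟩

lemma IsPartitionOfSigmaAlgebra.aeLe_partitionSigma (hC : IsPartitionOfSigmaAlgebra A μ C)
    (hA : A ≤ B) : AELe μ A (partitionSigma C) := by
  intro S hS
  obtain ⟨S', hS', hp, h⟩ := (hC.2 S (hA S hS)).2 ⟨S, hS, ae_eq_refl _⟩
  exact ⟨S', measurableSet_partitionSigma_iff.2 ⟨hS', hp⟩, h⟩

/-- If the measurable sets `S n` separate the elements of `β`, then modulo null sets every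
measurable `β ∨ C`-set belongs to the σ-algebra generated by `A` and the sets `S n`. -/
lemma partitionSigma_join_aeLe (hX : IsLebesgueSpace μ) (hC : IsPartitionOfSigmaAlgebra A μ C)
    {S : ℕ → Set X} (hS : ∀ n, MeasurableSet (S n))
    (hsep : ∀ x y, ¬ β x y → ∃ n, ¬ (x ∈ S n ↔ y ∈ S n)) :
    AELe μ (partitionSigma (partitionJoin β C))
      (⨆ k, A ⊔ MeasurableSpace.comap (firstCode S k) inferInstance) := by
  obtain ⟨T, hT, hTC, hTsep⟩ := hC.1
  intro E hE
  obtain ⟨hEm, hEp⟩ := measurableSet_partitionSigma_iff.1 hE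
  have hST : ∀ i, MeasurableSet (Sum.elim S T i) := by
    rintro (i | i)
    exacts [hS i, hT i]
  obtain ⟨E', hE', hEE'⟩ := hX.exists_ae_eq_of_separating hST hEm (measure_empty (μ := μ))
    fun x hx y hy => by
      have hxy : ¬ (β x y ∧ C x y) := fun h => hy.1 (hEp x y h hx.1)
      rcases not_and_or.1 hxy with h | h
      · obtain ⟨n, hn⟩ := hsep x y h
        exact ⟨Sum.inl n, hn⟩
      · obtain ⟨n, hn⟩ := hTsep x y h
        exact ⟨Sum.inr n, hn⟩
  have hgen : AELe μ (MeasurableSpace.generateFrom (Set.range (Sum.elim S T)))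
      (⨆ k, A ⊔ MeasurableSpace.comap (firstCode S k) inferInstance) := by
    refine AELe.generateFrom ?_
    rintro _ ⟨i | i, rfl⟩
    · have hle : MeasurableSpace.comap (firstCode S (i + 1)) inferInstance ≤
          ⨆ k, A ⊔ MeasurableSpace.comap (firstCode S k) inferInstance :=
        le_sup_right.trans (le_iSup (fun k => A ⊔ MeasurableSpace.comap (firstCode S k)
          inferInstance) (i + 1))
      exact ⟨S i, hle _ (measurableSet_comap_firstCode S i), ae_eq_refl _⟩
    · have hle : A ≤ ⨆ k, A ⊔ MeasurableSpace.comap (firstCode S k) inferInstance :=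
        le_sup_left.trans (le_iSup (fun k => A ⊔ MeasurableSpace.comap (firstCode S k)
          inferInstance) 0)
      obtain ⟨T', hT', h⟩ := hC.partitionSigma_aeLe (T i)
        (measurableSet_partitionSigma_iff.2 ⟨hT i, hTC i⟩)
      exact ⟨T', hle _ hT', h⟩
  obtain ⟨E'', hE'', h⟩ := hgen E' hE'
  exact ⟨E'', hE'', hEE'.trans h⟩

/-- If `α ≤ β` mod 0, the finite partitions which exhaust `α` have no entropy given `β`. -/
lemma finiteCondEntropy_eq_zero_of_partitionLE [IsProbabilityMeasure μ] (hX : IsLebesgueSpace μ)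
    (hA : A ≤ B) {α : Setoid X} (hle : PartitionLE μ α β)
    {S : ℕ → Set X} (hS : ∀ n, MeasurableSet (S n))
    (hsep : ∀ x y, ¬ β x y → ∃ n, ¬ (x ∈ S n ↔ y ∈ S n))
    {ι : ℕ → Type*} [∀ n, Fintype (ι n)] [∀ n, MeasurableSpace (ι n)]
    [∀ n, MeasurableSingletonClass (ι n)] {ξ : ∀ n, X → ι n} (hξ : Exhausts ξ α) (n : ℕ) :
    finiteCondEntropy μ (⨆ k, A ⊔ MeasurableSpace.comap (firstCode S k) inferInstance) (ξ n) =
      0 := by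
  obtain ⟨N, hN, hαβ⟩ := hle
  have hm : ⨆ k, A ⊔ MeasurableSpace.comap (firstCode S k) inferInstance ≤ B :=
    iSup_le fun k => sup_le hA (measurable_firstCode hS k).comap_le
  refine finiteCondEntropy_eq_zero hm fun i => ?_
  obtain ⟨E', hE', h⟩ := hX.exists_ae_eq_of_separating hS
    (hξ.measurable n (measurableSet_singleton i)) hN fun x hx y hy => hsep x y fun hxy => hy.1 (by
      have := (hξ.rel_iff x y).1 (hαβ x hx.2 y hy.2 hxy) n
      exact this.symm.trans hx.1)
  refine ⟨E', ?_, h⟩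
  refine MeasurableSpace.generateFrom_le ?_ E' hE'
  rintro _ ⟨k, rfl⟩
  have hle : MeasurableSpace.comap (firstCode S (k + 1)) inferInstance ≤
      ⨆ k, A ⊔ MeasurableSpace.comap (firstCode S k) inferInstance :=
    le_sup_right.trans (le_iSup (fun k => A ⊔ MeasurableSpace.comap (firstCode S k)
      inferInstance) (k + 1))
  exact hle _ (measurableSet_comap_firstCode S k)

end SigmaAlgebras

/-! ### The entropy of the action -/

lemma IsMeasurablePartition.exists_exhausts {X : Type*} [MeasurableSpace X] {α : Setoid X}
    (hα : IsMeasurablePartition α) :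
    ∃ S : ℕ → Set X, (∀ n, MeasurableSet (S n)) ∧
      (∀ x y, ¬ α x y → ∃ n, ¬ (x ∈ S n ↔ y ∈ S n)) ∧ Exhausts (firstCode S) α := by
  obtain ⟨S, hS, hSα, hsep⟩ := hα
  exact ⟨S, hS, hsep, exhausts_firstCode hS hSα hsep⟩

lemma nonempty_canonicalSystem_of_condEntropy_lt_top {X : Type*} [MeasurableSpace X]
    {μ : Measure X} {α C : Setoid X} (h : condEntropy μ α C < ⊤) :
    Nonempty (CanonicalSystem μ C) := by
  by_contra hne
  rw [condEntropy, dif_neg hne] at h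
  exact lt_irrefl _ h

lemma partitionOrbit_one {G X : Type*} [Group G] [MulAction G X] (α : Setoid X) :
    partitionOrbit α ({1} : Finset G) = α := by
  ext x y
  simp [partitionOrbit_iff]

/-- An invariant σ-algebra equals its preimage under every element of the group. -/
lemma comap_smul_eq_of_image_mem {G X : Type*} [Group G] [MulAction G X] {A : MeasurableSpace X}
    (hGA : ∀ (g : G) (S : Set X), MeasurableSet[A] S →
      MeasurableSet[A] ((fun x : X => g • x) '' S)) (g : G) :
    A.comap (fun x : X => g • x) = A := by
  refine le_antisymm ?_ fun S hS => ⟨_, hGA g S hS,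
    Set.preimage_image_eq S (MulAction.injective g)⟩
  rintro _ ⟨S, hS, rfl⟩
  have h : (fun x : X => g • x) ⁻¹' S = (fun x : X => g⁻¹ • x) '' S := by
    ext x
    constructor
    · exact fun hx => ⟨g • x, hx, inv_smul_smul g x⟩
    · rintro ⟨y, hy, rfl⟩
      simpa using hy
  rw [h]
  exact hGA g⁻¹ S hS

end

theorem theorem7 {G X : Type*} [Group G] [Countable G] [Infinite G] (hG : IsAmenableGroup G)
    (A : MeasurableSpace X) [B : MeasurableSpace X] (μ : Measure X) (hX : IsLebesgueSpace μ)
    [MulAction G X] (hT : ∀ g : G, MeasurePreserving (fun x : X => g • x) μ μ)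
    (hA : A ≤ B)
    (hGA : ∀ (g : G) (S : Set X), MeasurableSet[A] S →
      MeasurableSet[A] ((fun x : X => g • x) '' S))
    (C : Setoid X) (hC : IsPartitionOfSigmaAlgebra A μ C) :
    -- the limits that define the entropies exist
    (∀ α ∈ finiteCondEntropyPartitions μ C,
      Tendsto (meanOrbitEntropy (G := G) μ C α) (moreAndMoreInvariant G)
        (𝓝 (condEntropyOfAction G μ C α))) ∧
    ∀ α ∈ finiteCondEntropyPartitions μ C, ∀ β ∈ finiteCondEntropyPartitions μ C,
      condEntropyOfAction G μ C α ≤ condEntropy μ α C ∧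
      (partitionJoin α β ∈ finiteCondEntropyPartitions μ C ∧
        condEntropyOfAction G μ C (partitionJoin α β) ≤
          condEntropyOfAction G μ C α + condEntropyOfAction G μ C β) ∧
      (PartitionLE μ α β → condEntropyOfAction G μ C α ≤ condEntropyOfAction G μ C β) ∧
      condEntropyOfAction G μ C α ≤
        condEntropyOfAction G μ C β + condEntropy μ α (partitionJoin β C) := by
  classical
  have := hX.isProbabilityMeasure
  have := moreAndMoreInvariant_neBot hG
  have hGA' := comap_smul_eq_of_image_mem hGA
  have hCA := hC.partitionSigma_aeLe
  have hAC := hC.aeLe_partitionSigma hA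
  -- finiteness of one entropy given `C` provides a canonical system for `C`
  have key : ∀ α ∈ finiteCondEntropyPartitions μ C, ∀ F : Finset G, ∀ S : ℕ → Set X,
      Exhausts (firstCode S) α →
      condEntropy μ (partitionOrbit α F) C = orbitEntropy μ A (firstCode S) F :=
    fun α hα F S hS => condEntropy_partitionOrbit hA hT
      (nonempty_canonicalSystem_of_condEntropy_lt_top hα.2) hCA hAC hS F
  have hlim : ∀ α ∈ finiteCondEntropyPartitions μ C,
      Tendsto (meanOrbitEntropy (G := G) μ C α) (moreAndMoreInvariant G)
        (𝓝 (⨅ (K : Finset G) (_ : K.Nonempty),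
          condEntropy μ (partitionOrbit α K) C / (K.card : ℝ≥0∞))) := by
    intro α hα
    obtain ⟨S, hS, hsep, hex⟩ := hα.1.exists_exhausts
    refine tendsto_div_card_moreAndMoreInvariant fun K F => ?_
    rw [key α hα F S hex, key α hα K S hex]
    exact card_mul_orbitEntropy_le hA hT hGA' hex K F
  have hentropy : ∀ α ∈ finiteCondEntropyPartitions μ C,
      Tendsto (meanOrbitEntropy (G := G) μ C α) (moreAndMoreInvariant G)
        (𝓝 (condEntropyOfAction G μ C α)) := fun α hα =>
    tendsto_nhds_limUnder ⟨_, hlim α hα⟩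
  have hnonempty : ∀ᶠ F in moreAndMoreInvariant G, F.Nonempty :=
    (eventually_moreAndMoreInvariant (∅ : Finset G) one_pos).mono fun F hF => hF.1
  -- a bound which is linear in `|F|` passes to the limit
  have hbound : ∀ α ∈ finiteCondEntropyPartitions μ C, ∀ β ∈ finiteCondEntropyPartitions μ C,
      ∀ e : ℝ≥0∞, (∀ F : Finset G, condEntropy μ (partitionOrbit α F) C ≤
        condEntropy μ (partitionOrbit β F) C + F.card * e) →
      condEntropyOfAction G μ C α ≤ condEntropyOfAction G μ C β + e := by
    intro α hα β hβ e h
    refine le_of_tendsto_of_tendsto (hentropy α hα) ((hentropy β hβ).add_const e) ?_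
    filter_upwards [hnonempty] with F hF
    have hF0 : (F.card : ℝ≥0∞) ≠ 0 := by exact_mod_cast hF.card_pos.ne'
    refine (ENNReal.div_le_div_right (h F) _).trans_eq ?_
    rw [ENNReal.add_div, mul_comm, ENNReal.mul_div_cancel_right hF0 (ENNReal.natCast_ne_top _)]
    rfl
  refine ⟨hentropy, fun α hα β hβ => ⟨?_, ?_, fun hle => ?_, ?_⟩⟩
  · rw [tendsto_nhds_unique (hentropy α hα) (hlim α hα)]
    refine (iInf₂_le ({1} : Finset G) (Finset.singleton_nonempty 1)).trans_eq ?_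
    rw [partitionOrbit_one]
    simp
  · obtain ⟨S, hS, hSsep, hSex⟩ := hα.1.exists_exhausts
    obtain ⟨T, hTm, hTsep, hTex⟩ := hβ.1.exists_exhausts
    have hadd : ∀ F : Finset G, condEntropy μ (partitionOrbit (partitionJoin α β) F) C ≤
        condEntropy μ (partitionOrbit α F) C + condEntropy μ (partitionOrbit β F) C := by
      intro F
      rw [key α hα F S hSex, key β hβ F T hTex, condEntropy_partitionOrbit hA hT
        (nonempty_canonicalSystem_of_condEntropy_lt_top hα.2) hCA hAC (hSex.join hTex) F]
      exact orbitEntropy_prod_le hA hT hSex hTex F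
    have hmem : partitionJoin α β ∈ finiteCondEntropyPartitions μ C := by
      refine ⟨hα.1.join hβ.1, ?_⟩
      have h := hadd {1}
      rw [partitionOrbit_one, partitionOrbit_one, partitionOrbit_one] at h
      exact h.trans_lt (ENNReal.add_lt_top.2 ⟨hα.2, hβ.2⟩)
    refine ⟨hmem, le_of_tendsto_of_tendsto' (hentropy _ hmem)
      ((hentropy α hα).add (hentropy β hβ)) fun F => ?_⟩
    refine (ENNReal.div_le_div_right (hadd F) _).trans_eq ?_
    rw [ENNReal.add_div]
    rfl
  · obtain ⟨S, hS, hSsep, hSex⟩ := hα.1.exists_exhausts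
    obtain ⟨T, hTm, hTsep, hTex⟩ := hβ.1.exists_exhausts
    have h := hbound α hα β hβ 0 fun F => by
      rw [key α hα F S hSex, key β hβ F T hTex]
      refine orbitEntropy_le_add hA hT hGA' hSex hTex (fun n => ?_) F
      rw [finiteCondEntropy_eq_zero_of_partitionLE hX hA hle hTm hTsep hSex n]
      simp
    simpa using h
  · -- A canonical system for `β ∨ C` always exists by Rokhlin's theorem, which is not needed here:
    -- without one the right-hand side would be `⊤`.
    by_cases hD : Nonempty (CanonicalSystem μ (partitionJoin β C))
    swap
    · rw [show condEntropy μ α (partitionJoin β C) = ⊤ from dif_neg hD, add_top]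
      exact le_top
    obtain ⟨S, hS, hSsep, hSex⟩ := hα.1.exists_exhausts
    obtain ⟨T, hTm, hTsep, hTex⟩ := hβ.1.exists_exhausts
    refine hbound α hα β hβ _ fun F => ?_
    rw [key α hα F S hSex, key β hβ F T hTex]
    refine orbitEntropy_le_add hA hT hGA' hSex hTex (fun n => ?_) F
    rw [condEntropy_eq_iSup hD hSex.measurable hSex.refines hSex.rel_iff]
    refine le_trans (ENNReal.ofReal_le_ofReal ?_) (le_iSup (fun n => ENNReal.ofReal
      (finiteCondEntropy μ (partitionSigma (partitionJoin β C)) (firstCode S n))) n)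
    exact finiteCondEntropy_anti (partitionSigma_le _)
      (iSup_le fun k => sup_le hA (hTex.measurable k).comap_le)
      (partitionSigma_join_aeLe hX hC hTm hTsep) (hSex.measurable n)
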